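/- **Notation.** Let $\mathbb H$ be the upper half-plane, $q=e^{2\pi i\tau}$, $\eta=q^{1/24}\prod_{m\ge1}(1-q^m)$, $\Delta=\eta^{24}$, $E_4=1+240\sum_{m\ge1}\sigma_3(m)q^m$, $E_6=1-504\sum_{m\ge1}\sigma_5(m)q^m$, and $J=E_4^3/(1728\Delta)$ (so $J(i)=1$). The Schwarz derivative is $\{h,\tau\}=\left(\frac{h''}{h'}\right)'-\frac12\left(\frac{h''}{h'}\right)^2$. **Theorem.** Let $n\ge 0$ be an integer and let $x_1,\dots,x_n\in(0,1)$ be pairwise distinct real numbers solving the system $E^n_{4,9,12}$: $$\frac{4}{x_j}+\frac{9}{x_j-1}+\sum_{k\ne j}\frac{12}{x_j-x_k}=0,\qquad 1\le j\le n.$$ Let $w_j\in\mathbb H$ satisfy $J(w_j)=x_j$ for $1\le j\le n$, and set $$f_n=\frac{\eta^4}{(J-1)\prod_{j=1}^n(J-x_j)^2}.$$ Then: 1. $\displaystyle f_n=1728\,\frac{\eta^{28}}{E_6^2\prod_{j=1}^n(J-x_j)^2}$. 2. $f_n$ is a meromorphic modular form of weight $2$ for $\mathrm{SL}_2(\mathbb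 Z)$ with a character: it is meromorphic on $\mathbb H$, there is a homomorphism $\chi:\mathrm{SL}_2(\mathbb Z)\to\mathbb C^\times$ with $f_n\left(\frac{a\tau+b}{c\tau+d}\right)=\chi(\gamma)(c\tau+d)^2f_n(\tau)$ for all $\gamma=\begin{pmatrix}a&b\\c&d\end{pmatrix}\in\mathrm{SL}_2(\mathbb Z)$, and it is meromorphic in $e^{2\pi i\tau/6}$ at the cusp. 3. $f_n$ has a double pole with zero residue at $i$, at each $w_j$, and at every point of $\mathbb H$ that is $\mathrm{SL}_2(\mathbb Z)$-equivalent to one of these; at all other points of $\mathbb H$ it is holomorphic and nonzero. 4. $f_n$ has a meromorphic primitive on $\mathbb H$, and every meromorphic primitive $h_n$ of $f_n$ on $\mathbb H$ satisfies $$\{h_n,\tau\}=2\pi^2\left(\frac{12n+7}{6}\right)^2E_4(\tau)$$ at every point of $\mathbb H$ where $f_n$ is holomorphic (hence as meromorphic functions on $\mathbb H$). -/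

import Mathlib

open UpperHalfPlane
open scoped MatrixGroups ModularForm

/-- `x = (x₁, …, xₙ)` solves the algebraic system `Eⁿ_{a,b,c}`:
`a / xᵢ + b / (xᵢ - 1) + ∑_{j ≠ i} c / (xᵢ - xⱼ) = 0` for every `i`.
All denominators are required to be nonzero. -/
def SolvesSystem (a b c : ℝ) {n : ℕ} (x : Fin n → ℝ) : Prop :=
  Function.Injective x ∧ (∀ i, x i ≠ 0 ∧ x i ≠ 1) ∧
    ∀ i, a / x i + b / (x i - 1) + ∑ j ∈ Finset.univ.erase i, c / (x i - x j) = 0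

/-- The elliptic modular function `J = E₄³ / (1728 Δ)`, normalised by `J(i) = 1`. -/
noncomputable def kleinJ (τ : ℍ) : ℂ :=
  ModularForm.E₄ τ ^ 3 / (1728 * ModularForm.discriminant τ)

/-- `fₙ = η⁴ / ((J - 1) ∏ᵢ (J - xᵢ)²)`; Lean's division gives it the value `0` at its poles. -/
noncomputable def formF {n : ℕ} (x : Fin n → ℝ) (τ : ℍ) : ℂ :=
  ModularForm.eta τ ^ 4 / ((kleinJ τ - 1) * ∏ i, (kleinJ τ - (x i : ℂ)) ^ 2)

/-- `f` is a meromorphic modular form of weight `2` for `SL(2, ℤ)` with character `χ`.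
A meromorphic function on `ℍ` is represented by the function with value `0` at the poles
(its normal form). As `χ` is trivial on the sixth power of the translation `T`, the condition at
the cusp is that `f` be meromorphic in `exp(2πiτ/6)` near `0`. -/
structure IsMeromorphicModularFormWtTwo (χ : SL(2, ℤ) →* ℂˣ) (f : ℍ → ℂ) : Prop where
  meromorphic : MeromorphicNFOn (f ∘ ofComplex) upperHalfPlaneSet
  slash_eq : ∀ γ : SL(2, ℤ), f ∣[(2 : ℤ)] γ = fun τ ↦ (χ γ : ℂ) * f τ
  meromorphic_at_cusp : ∃ F : ℂ → ℂ, MeromorphicAt F 0 ∧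
    ∀ᶠ τ : ℍ in atImInfty, f τ = F (Function.Periodic.qParam 6 τ)

/-- The function `g`, meromorphic at `z₀`, has residue `a` at `z₀`:
`(2πi)⁻¹ ∮ g(z) dz = a` over all sufficiently small circles around `z₀`. -/
def HasResidueAt (g : ℂ → ℂ) (z₀ a : ℂ) : Prop :=
  MeromorphicAt g z₀ ∧ ∀ᶠ r : ℝ in nhdsWithin 0 (Set.Ioi 0),
    (2 * (Real.pi : ℂ) * Complex.I)⁻¹ * (∮ z in C(z₀, r), g z) = a

/-- `h` is an integral (meromorphic primitive) on `ℍ` of the meromorphic function `f`: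
it is meromorphic, and `h' = f` at each point where `f` is holomorphic. -/
def IsMeromorphicPrimitive (f h : ℍ → ℂ) : Prop :=
  MeromorphicOn (h ∘ ofComplex) upperHalfPlaneSet ∧
    ∀ τ : ℍ, AnalyticAt ℂ (f ∘ ofComplex) τ → HasDerivAt (h ∘ ofComplex) (f τ) τ

/-- The Schwarz derivative `{g, z} = (g''/g')' - (1/2) (g''/g')²`. -/
noncomputable def schwarzDeriv (g : ℂ → ℂ) (z : ℂ) : ℂ :=
  deriv (fun u ↦ deriv (deriv g) u / deriv g u) z - (1 / 2) * (deriv (deriv g) z / deriv g z) ^ 2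

/-- `τ` is `SL(2, ℤ)`-equivalent to `i` or to one of the points `wⱼ`. -/
def IsEquivToIOrW {n : ℕ} (w : Fin n → ℍ) (τ : ℍ) : Prop :=
  τ ∈ MulAction.orbit SL(2, ℤ) UpperHalfPlane.I ∨
    ∃ j, τ ∈ MulAction.orbit SL(2, ℤ) (w j)

/-! Let p be the monic polynomial with roots x_j and Y = E₆ p(J) / η^14 (`nodeForm`), a holomorphic
form of weight -1. Then f_n = 1728 / Y², so everything reduces to Y.

The system says exactly that p solves a hypergeometric equation (`nodePoly_hypergeometric`). With
Ramanujan's formulas for the derivatives of E₂, E₄, E₆ this becomes Y'' = -π² ((12n+7)/6)² E₄ Y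
(`hasDerivAt_deriv_nodeForm`). If h' = 1728 / Y², then {h, τ} = -2 Y''/Y, which is the Schwarzian
claim.

For the primitive, take a second form Z = E₄ L(J) / η^10 of weight -1. The Wronskian Z'Y - ZY' is
2πi times a polynomial in J, and L can be interpolated so that it equals 2πi (1728 + Y² v(J) η⁴)
(`exists_interpolating_poly`, `auxForm_nodeForm_wronskian_eq`). Dividing by Y², 1728 / Y² is the
derivative of Z / (2πi Y) minus a primitive of the holomorphic function v(J) η⁴. So the residues
vanish, and at a zero of Y the Wronskian is nonzero, so that zero is simple and the pole of f_n
double.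

The zeros of Y are the points with J = 1 = J(i) or J = x_j = J(w_j). That these are single orbits is
the injectivity of J modulo SL(2, ℤ) (`mem_orbit_of_kleinJ_eq`): equal J forces all Eisenstein
values to scale, hence two lattices to share their ℘-function, hence to coincide. -/

open Filter Topology Manifold Derivative

/-! ### Ramanujan's identities for E₂, E₄, E₆. -/

/-- A weakly modular holomorphic function of level one and weight below `12` that vanishes at the
cusp is zero. -/
lemma eq_zero_of_slash_invariant_of_isZeroAtImInfty {k : ℤ} (hk : k < 12) {F : ℍ → ℂ}
    (hF : MDiff F) (hinv : ∀ γ : SL(2, ℤ), F ∣[k] γ = F) (h0 : IsZeroAtImInfty F) : F = 0 := by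
  let G : CuspForm 𝒮ℒ k :=
    { toFun := F
      slash_action_eq' := by
        rintro _ ⟨A, rfl⟩
        exact hinv A
      holo' := hF
      zero_at_cusps' := fun hc ↦ by
        rw [Subgroup.IsArithmetic.isCusp_iff_isCusp_SL2Z] at hc
        rw [OnePoint.isZeroAt_iff_forall_SL2Z hc]
        intro γ _
        rw [hinv]
        exact h0 }
  have : G = 0 := rank_zero_iff_forall_zero.mp (CuspForm.rank_eq_zero_of_weight_lt_twelve hk) G
  exact congrArg DFunLike.coe this

/-- The normalized derivative of a bounded periodic function vanishes at the cusp. -/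
lemma isZeroAtImInfty_normalizedDeriv {F : ℍ → ℂ} (hF : MDiff F)
    (hper : Function.Periodic (F ∘ ofComplex) (1 : ℝ)) (hbd : IsBoundedAtImInfty F) :
    IsZeroAtImInfty (normalizedDerivOfComplex F) := by
  have han := analyticAt_cuspFunction_zero one_pos hper hF hbd
  have hq := UpperHalfPlane.qParam_tendsto_atImInfty one_pos
  -- In terms of Φ(q) = F(τ), the normalized derivative is q Φ'(q), and q tends to 0.
  have hlim : Tendsto (fun τ : ℍ ↦ deriv (cuspFunction 1 F) (Function.Periodic.qParam 1 τ) *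
      Function.Periodic.qParam 1 τ) atImInfty (𝓝 (deriv (cuspFunction 1 F) 0 * 0)) :=
    (han.deriv.continuousAt.tendsto.comp hq).mul hq
  rw [mul_zero] at hlim
  refine hlim.congr fun τ ↦ ?_
  have hE : F ∘ ofComplex =ᶠ[𝓝 (τ : ℂ)]
      fun z ↦ cuspFunction 1 F (Function.Periodic.qParam 1 z) := by
    filter_upwards [isOpen_upperHalfPlaneSet.mem_nhds τ.im_pos] with z hz
    have := eq_cuspFunction ⟨z, hz⟩ one_ne_zero hper
    rw [Function.comp_apply, ofComplex_apply_of_im_pos hz, ← this]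
  have h1 : HasDerivAt (cuspFunction 1 F)
      (deriv (cuspFunction 1 F) (Function.Periodic.qParam 1 τ)) (Function.Periodic.qParam 1 τ) :=
    (differentiableAt_cuspFunction one_pos hper hF hbd
      (Function.Periodic.norm_qParam_lt_one one_pos τ.im_pos)).hasDerivAt
  have h2 : HasDerivAt (fun z : ℂ ↦ Function.Periodic.qParam 1 z)
      (Function.Periodic.qParam 1 τ * (2 * Real.pi * Complex.I)) τ := by
    have : HasDerivAt (fun z : ℂ ↦ 2 * Real.pi * Complex.I * z / (1 : ℝ))
      (2 * Real.pi * Complex.I) τ := by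
      simpa using (hasDerivAt_id (τ : ℂ)).const_mul (2 * Real.pi * Complex.I)
    exact this.cexp
  have := (h1.comp (τ : ℂ) h2).congr_of_eventuallyEq hE
  rw [normalizedDerivOfComplex, this.deriv]
  field [Complex.two_pi_I_ne_zero]

lemma periodic_comp_ofComplex_of_slash_T {k : ℤ} {F : ℍ → ℂ}
    (h : F ∣[k] ModularGroup.T = F) : Function.Periodic (F ∘ ofComplex) (1 : ℝ) := by
  intro w
  by_cases hw : 0 < w.im
  · have hw' : 0 < (w + (1 : ℝ)).im := by simpa using hw
    have h1 : (⟨w + (1 : ℝ), hw'⟩ : ℍ) = (1 : ℝ) +ᵥ (⟨w, hw⟩ : ℍ) := by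
      apply UpperHalfPlane.ext
      simp [add_comm]
    have := congrFun h ⟨w, hw⟩
    rw [ModularForm.SL_slash_apply, modular_T_smul] at this
    simp only [Function.comp_apply, ofComplex_apply_of_im_pos hw, ofComplex_apply_of_im_pos hw', h1]
    have hd : denom (ModularGroup.T : SL(2, ℤ)) (w : ℂ) = 1 := by
      simp [denom, ModularGroup.coe_T]
    rw [← this, show ((⟨w, hw⟩ : ℍ) : ℂ) = w from rfl, hd, one_zpow, mul_one]
  -- Off the half-plane `ofComplex` takes one constant default value.
  · have hw' : (w + (1 : ℝ)).im ≤ 0 := by simpa using hw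
    rw [Function.comp_apply, Function.comp_apply, ofComplex_apply_of_im_nonpos hw',
      ofComplex_apply_of_im_nonpos (not_lt.mp hw)]

open EisensteinSeries in
lemma E2_slash_T : E2 ∣[(2 : ℤ)] ModularGroup.T = E2 := by
  rw [E2_slash_action, D2_T, smul_zero, sub_zero]

open EisensteinSeries in
lemma tendsto_E2_atImInfty : Tendsto E2 atImInfty (𝓝 1) := by
  have hper := periodic_comp_ofComplex_of_slash_T E2_slash_T
  have han := analyticAt_cuspFunction_zero one_pos hper E2_mdifferentiable isBoundedAtImInfty_E2
  have h := han.continuousAt.tendsto.comp (UpperHalfPlane.qParam_tendsto_atImInfty one_pos)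
  have hs := UpperHalfPlane.hasFPowerSeriesOnBall_cuspFunction one_pos han
    (c := fun m : ℕ ↦ (if m = 0 then 1 else -24 * ArithmeticFunction.sigma 1 m : ℂ))
    fun τ ↦ by
      simpa only [Function.Periodic.qParam, Complex.ofReal_one, div_one] using
        hasSum_qExpansion_E2 (z := τ)
  have h0 : cuspFunction 1 E2 0 = 1 := by
    have := hs.coeff_zero 0
    simpa [FormalMultilinearSeries.ofScalars] using this.symm
  rw [h0] at h
  refine h.congr fun τ ↦ ?_
  exact eq_cuspFunction τ one_ne_zero hper

lemma tendsto_E_atImInfty {k : ℕ} (hk : 3 ≤ k) (hk2 : Even k) :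
    Tendsto (ModularForm.E hk) atImInfty (𝓝 1) := by
  have han := ModularFormClass.analyticAt_cuspFunction_zero (ModularForm.E hk) one_pos
    one_mem_strictPeriods_SL
  have h := han.continuousAt.tendsto.comp (UpperHalfPlane.qParam_tendsto_atImInfty one_pos)
  have h0 := EisensteinSeries.E_qExpansion_coeff_zero hk hk2
  rw [UpperHalfPlane.qExpansion_coeff] at h0
  simp only [Nat.factorial_zero, Nat.cast_one, inv_one, iteratedDeriv_zero, one_mul] at h0
  rw [h0] at h
  exact h.congr fun τ ↦
    SlashInvariantFormClass.eq_cuspFunction _ τ one_mem_strictPeriods_SL one_ne_zero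

lemma slash_E {k : ℕ} (hk : 3 ≤ k) (γ : SL(2, ℤ)) :
    (ModularForm.E hk : ℍ → ℂ) ∣[(k : ℤ)] γ = ModularForm.E hk :=
  SlashInvariantFormClass.slash_action_eq (ModularForm.E hk) _ ⟨γ, rfl⟩

lemma mdifferentiable_E {k : ℕ} (hk : 3 ≤ k) : MDiff (ModularForm.E hk : ℍ → ℂ) :=
  (ModularForm.E hk).holo'

/-- The Serre derivative of a level one form with value `1` at the cusp takes the value
`-k / 12` there. -/
lemma tendsto_serreDerivative_E {k : ℕ} (hk : 3 ≤ k) (hk2 : Even k) :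
    Tendsto (serreDerivative k (ModularForm.E hk)) atImInfty (𝓝 (-k / 12)) := by
  have h1 : Tendsto (normalizedDerivOfComplex (ModularForm.E hk)) atImInfty (𝓝 0) :=
    isZeroAtImInfty_normalizedDeriv (mdifferentiable_E hk)
      (periodic_comp_ofComplex_of_slash_T (slash_E hk _)) (ModularFormClass.bdd_at_infty _)
  have := h1.sub ((tendsto_E2_atImInfty.const_mul ((k : ℂ) * 12⁻¹)).mul
    (tendsto_E_atImInfty hk hk2))
  convert! this using 2
  ring

lemma serreDerivative_E_slash {k : ℕ} (hk : 3 ≤ k) (γ : SL(2, ℤ)) :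
    serreDerivative k (ModularForm.E hk) ∣[(k + 2 : ℤ)] γ = serreDerivative k (ModularForm.E hk) := by
  have := serreDerivative_slash_invariant (k := (k : ℤ)) (mdifferentiable_E hk) (slash_E hk γ)
  simpa using this

/-- Ramanujan's identity for `E₄`. -/
lemma serreDerivative_E₄ (τ : ℍ) :
    serreDerivative 4 ModularForm.E₄ τ = -ModularForm.E₆ τ / 3 := by
  -- The factor 1/3 cancels the constant term -4/12 of the Serre derivative.
  have h : serreDerivative 4 ModularForm.E₄ + (1 / 3 : ℂ) • (ModularForm.E₆ : ℍ → ℂ) = 0 := by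
    refine eq_zero_of_slash_invariant_of_isZeroAtImInfty (k := 6) (by norm_num) ?_ ?_ ?_
    · exact (serreDerivative_mdifferentiable _ (mdifferentiable_E _)).add
        ((mdifferentiable_E _).const_smul _)
    · intro γ
      rw [SlashAction.add_slash, ModularForm.SL_smul_slash]
      have h1 : serreDerivative 4 (ModularForm.E _) ∣[(6 : ℤ)] γ = _ :=
        serreDerivative_E_slash (k := 4) (by norm_num) γ
      have h2 : (ModularForm.E₆ : ℍ → ℂ) ∣[(6 : ℤ)] γ = _ := slash_E (k := 6) (by norm_num) γ
      rw [h1, h2]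
      rfl
    · have h1 := tendsto_serreDerivative_E (k := 4) (by norm_num) ⟨2, rfl⟩
      have h2 := (tendsto_E_atImInfty (k := 6) (by norm_num) ⟨3, rfl⟩).const_mul (1 / 3 : ℂ)
      have := h1.add h2
      rwa [show -((4 : ℕ) : ℂ) / 12 + 1 / 3 * 1 = 0 by norm_num] at this
  have := congrFun h τ
  simp only [Pi.add_apply, Pi.smul_apply, smul_eq_mul, Pi.zero_apply] at this
  linear_combination this

/-- Ramanujan's identity for `E₆`. -/
lemma serreDerivative_E₆ (τ : ℍ) :
    serreDerivative 6 ModularForm.E₆ τ = -ModularForm.E₄ τ ^ 2 / 2 := by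
  have h : serreDerivative 6 ModularForm.E₆ +
      (1 / 2 : ℂ) • ((ModularForm.E₄ : ℍ → ℂ) * (ModularForm.E₄ : ℍ → ℂ)) = 0 := by
    refine eq_zero_of_slash_invariant_of_isZeroAtImInfty (k := 8) (by norm_num) ?_ ?_ ?_
    · exact (serreDerivative_mdifferentiable _ (mdifferentiable_E _)).add
        (((mdifferentiable_E _).mul (mdifferentiable_E _)).const_smul _)
    · intro γ
      rw [SlashAction.add_slash, ModularForm.SL_smul_slash]
      have h1 : serreDerivative 6 (ModularForm.E _) ∣[(8 : ℤ)] γ = _ :=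
        serreDerivative_E_slash (k := 6) (by norm_num) γ
      have h2 : (ModularForm.E₄ : ℍ → ℂ) ∣[(4 : ℤ)] γ = _ := slash_E (k := 4) (by norm_num) γ
      have h3 := ModularForm.mul_slash_SL2 4 4 γ ModularForm.E₄ ModularForm.E₄
      norm_num only at h3
      rw [h1, h3, h2]
      rfl
    · have h1 := tendsto_serreDerivative_E (k := 6) (by norm_num) ⟨3, rfl⟩
      have h2 := tendsto_E_atImInfty (k := 4) (by norm_num) ⟨2, rfl⟩
      have := h1.add ((h2.mul h2).const_mul (1 / 2 : ℂ))
      rwa [show -((6 : ℕ) : ℂ) / 12 + 1 / 2 * (1 * 1) = 0 by norm_num] at this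
  have := congrFun h τ
  simp only [Pi.add_apply, Pi.smul_apply, Pi.mul_apply, smul_eq_mul, Pi.zero_apply] at this
  linear_combination this

-- The function c/(cτ+d) is, up to a constant, the defect of E₂ under the slash action. That its
-- derivative is a multiple of its square lets the defect of E₂' cancel that of E₂².
open EisensteinSeries in
lemma normalizedDeriv_div_denom (γ : SL(2, ℤ)) (τ : ℍ) :
    normalizedDerivOfComplex (fun z : ℍ ↦ (γ 1 0 : ℂ) / denom γ z) τ =
      -(2 * Real.pi * Complex.I)⁻¹ * ((γ 1 0 : ℂ) / denom γ τ) ^ 2 := by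
  have hden : denom γ τ ≠ 0 := denom_ne_zero _ _
  have hd : HasDerivAt (fun z : ℂ ↦ denom γ z) (γ 1 0 : ℂ) τ := by
    simpa [denom] using ((hasDerivAt_id (τ : ℂ)).const_mul (γ 1 0 : ℂ)).add_const (γ 1 1 : ℂ)
  have h2 := ((hasDerivAt_const (τ : ℂ) (γ 1 0 : ℂ)).div hd hden)
  have hE : (fun z : ℍ ↦ (γ 1 0 : ℂ) / denom γ z) ∘ ofComplex =ᶠ[𝓝 (τ : ℂ)]
      fun z : ℂ ↦ (γ 1 0 : ℂ) / denom γ z := by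
    filter_upwards [isOpen_upperHalfPlaneSet.mem_nhds τ.im_pos] with z hz
    rw [Function.comp_apply, ofComplex_apply_of_im_pos hz]
  rw [normalizedDerivOfComplex, (h2.congr_of_eventuallyEq hE).deriv]
  field_simp
  ring

open EisensteinSeries in
/-- Ramanujan's identity for `E₂`. -/
lemma normalizedDeriv_E2 (τ : ℍ) :
    normalizedDerivOfComplex E2 τ = (E2 τ ^ 2 - ModularForm.E₄ τ) / 12 := by
  set b : ℂ := (2 * Real.pi * Complex.I)⁻¹ with hb
  -- Neither term is modular of weight 4. Their defects, linear and quadratic in c/(cτ+d), agree and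
  -- cancel in the difference.
  let F : ℍ → ℂ := normalizedDerivOfComplex E2 - (1 / 12 : ℂ) • (E2 * E2)
  have hFmd : MDiff F := (normalizedDerivOfComplex_mdifferentiable E2_mdifferentiable).sub
    ((E2_mdifferentiable.mul E2_mdifferentiable).const_smul _)
  have hFinv (γ : SL(2, ℤ)) : F ∣[(4 : ℤ)] γ = F := by
    let u : ℍ → ℂ := fun z : ℍ ↦ (γ 1 0 : ℂ) / denom γ z
    have hu : MDiff u := by
      rw [mdifferentiable_iff]
      refine DifferentiableOn.congr (f := fun z : ℂ ↦ (γ 1 0 : ℂ) / denom γ z) ?_ fun z hz ↦ by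
        simp [u, ofComplex_apply_of_im_pos hz]
      refine (differentiableOn_const _).div (by unfold denom; fun_prop) fun z hz ↦
        denom_ne_zero γ ⟨z, hz⟩
    have hE2 : E2 ∣[(2 : ℤ)] γ = E2 + (12 * b) • u := by
      rw [E2_slash_action]
      ext z
      simp only [Pi.sub_apply, Pi.add_apply, Pi.smul_apply, D2, smul_eq_mul, riemannZeta_two, u, b]
      have : (Real.pi : ℂ) ≠ 0 := mod_cast Real.pi_ne_zero
      field_simp
      linear_combination (-12 : ℂ) * (γ 1 0 : ℂ) * Complex.I_sq
    have h1 := normalizedDerivOfComplex_SL_slash (k := 2) E2_mdifferentiable (γ := γ)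
    rw [hE2, normalizedDerivOfComplex_add _ _ E2_mdifferentiable (hu.const_smul _),
      normalizedDerivOfComplex_smul _ _ hu] at h1
    have h2 := ModularForm.mul_slash_SL2 2 2 γ E2 E2
    norm_num only at h1 h2
    change (normalizedDerivOfComplex E2 - (1 / 12 : ℂ) • (E2 * E2)) ∣[(4 : ℤ)] γ = _
    rw [sub_eq_add_neg, SlashAction.add_slash, SlashAction.neg_slash, ModularForm.SL_smul_slash, h2,
      hE2]
    ext z
    have h3 := congrFun h1 z
    have h4 : normalizedDerivOfComplex u z = -b * u z ^ 2 := normalizedDeriv_div_denom γ z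
    simp only [Pi.add_apply, Pi.sub_apply, Pi.neg_apply, Pi.smul_apply, Pi.mul_apply, smul_eq_mul,
      h4, F] at h3 ⊢
    have h5 : (γ 1 0 : ℂ) / denom γ z = u z := rfl
    rw [h5] at h3
    linear_combination -h3
  have h : F + (1 / 12 : ℂ) • (ModularForm.E₄ : ℍ → ℂ) = 0 := by
    refine eq_zero_of_slash_invariant_of_isZeroAtImInfty (k := 4) (by norm_num) ?_ ?_ ?_
    · exact hFmd.add ((mdifferentiable_E _).const_smul _)
    · intro γ
      have h2 : (ModularForm.E₄ : ℍ → ℂ) ∣[(4 : ℤ)] γ = _ := slash_E (k := 4) (by norm_num) γ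
      rw [SlashAction.add_slash, ModularForm.SL_smul_slash, hFinv, h2]
    · have h1 : Tendsto (normalizedDerivOfComplex E2) atImInfty (𝓝 0) :=
        isZeroAtImInfty_normalizedDeriv E2_mdifferentiable
          (periodic_comp_ofComplex_of_slash_T E2_slash_T) isBoundedAtImInfty_E2
      have h2 := tendsto_E_atImInfty (k := 4) (by norm_num) ⟨2, rfl⟩
      have := (h1.sub ((tendsto_E2_atImInfty.mul tendsto_E2_atImInfty).const_mul
        (1 / 12 : ℂ))).add (h2.const_mul (1 / 12 : ℂ))
      rwa [show (0 : ℂ) - 1 / 12 * (1 * 1) + 1 / 12 * 1 = 0 by norm_num] at this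
  have := congrFun h τ
  simp only [Pi.add_apply, Pi.sub_apply, Pi.smul_apply, Pi.mul_apply, smul_eq_mul, Pi.zero_apply,
    F] at this
  linear_combination this

/-! ### Derivatives of E₂, E₄, E₆, η and J. -/

lemma hasDerivAt_comp_ofComplex {F : ℍ → ℂ} (hF : MDiff F) (τ : ℍ) :
    HasDerivAt (F ∘ ofComplex) (2 * Real.pi * Complex.I * normalizedDerivOfComplex F τ) τ := by
  have := (mdifferentiableAt_iff.mp (hF τ)).hasDerivAt
  rwa [normalizedDerivOfComplex, mul_inv_cancel_left₀ Complex.two_pi_I_ne_zero]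

lemma hasDerivAt_E2 (τ : ℍ) : HasDerivAt (EisensteinSeries.E2 ∘ ofComplex)
    (2 * Real.pi * Complex.I * ((EisensteinSeries.E2 τ ^ 2 - ModularForm.E₄ τ) / 12)) τ :=
  normalizedDeriv_E2 τ ▸ hasDerivAt_comp_ofComplex E2_mdifferentiable τ

lemma hasDerivAt_E₄ (τ : ℍ) : HasDerivAt (ModularForm.E₄ ∘ ofComplex)
    (2 * Real.pi * Complex.I *
      ((EisensteinSeries.E2 τ * ModularForm.E₄ τ - ModularForm.E₆ τ) / 3)) τ := by
  convert! hasDerivAt_comp_ofComplex (mdifferentiable_E _) τ using 2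
  have h := serreDerivative_E₄ τ
  rw [serreDerivative_apply] at h
  linear_combination -h

lemma hasDerivAt_E₆ (τ : ℍ) : HasDerivAt (ModularForm.E₆ ∘ ofComplex)
    (2 * Real.pi * Complex.I *
      ((EisensteinSeries.E2 τ * ModularForm.E₆ τ - ModularForm.E₄ τ ^ 2) / 2)) τ := by
  convert! hasDerivAt_comp_ofComplex (mdifferentiable_E _) τ using 2
  have h := serreDerivative_E₆ τ
  rw [serreDerivative_apply] at h
  linear_combination -h

lemma hasDerivAt_eta (τ : ℍ) : HasDerivAt ModularForm.eta
    (2 * Real.pi * Complex.I * (EisensteinSeries.E2 τ / 24 * ModularForm.eta τ)) τ := by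
  have h := ModularForm.logDeriv_eta_eq_E2 τ
  rw [logDeriv_apply, div_eq_iff (ModularForm.eta_ne_zero τ.2)] at h
  convert! (ModularForm.differentiableAt_eta_of_mem_upperHalfPlaneSet τ.2).hasDerivAt using 1
  rw [h]
  ring

/-- Since J has weight 0, the E₂ contributions of E₄³ and η^24 cancel. -/
lemma hasDerivAt_kleinJ (τ : ℍ) : HasDerivAt (kleinJ ∘ ofComplex)
    (2 * Real.pi * Complex.I *
      -(ModularForm.E₄ τ ^ 2 * ModularForm.E₆ τ / (1728 * ModularForm.eta τ ^ 24))) τ := by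
  have hη : ModularForm.eta τ ≠ 0 := ModularForm.eta_ne_zero τ.2
  have h := ((hasDerivAt_E₄ τ).fun_pow 3).fun_div (((hasDerivAt_eta τ).fun_pow 24).const_mul 1728)
    (mul_ne_zero (by norm_num) (pow_ne_zero 24 hη))
  refine (h.congr_of_eventuallyEq ?_).congr_deriv ?_
  · filter_upwards [isOpen_upperHalfPlaneSet.mem_nhds τ.im_pos] with z hz
    simp only [Function.comp_apply, kleinJ, ModularForm.discriminant, ofComplex_apply_of_im_pos hz]
  · simp only [Function.comp_apply, ofComplex_apply]
    field_simp
    ring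

/-! ### The polynomial side: from the algebraic system to differential equations. -/

section StieltjesBethe

open Polynomial

variable {n : ℕ} (x : Fin n → ℂ)

/-- The monic polynomial with roots `x i`. -/
noncomputable def nodePoly : ℂ[X] := ∏ i, (X - C (x i))

/-- The companion `p / 2 + (X - 1) p'` of the node polynomial `p`. -/
noncomputable def nodeCompanion : ℂ[X] :=
  C (1 / 2) * nodePoly x + (X - 1) * derivative (nodePoly x)

lemma nodePoly_eval (z : ℂ) : (nodePoly x).eval z = ∏ i, (z - x i) := by
  simp [nodePoly, eval_prod]

lemma nodePoly_eval_node (j : Fin n) : (nodePoly x).eval (x j) = 0 := by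
  rw [nodePoly_eval]
  exact Finset.prod_eq_zero (Finset.mem_univ j) (sub_self _)

lemma nodePoly_natDegree : (nodePoly x).natDegree = n := by
  rw [nodePoly, natDegree_prod_of_monic _ _ fun _ _ ↦ monic_X_sub_C _]
  simp

lemma nodePoly_eq_mul (j : Fin n) :
    nodePoly x = (X - C (x j)) * ∏ i ∈ Finset.univ.erase j, (X - C (x i)) :=
  (Finset.mul_prod_erase _ _ (Finset.mem_univ j)).symm

lemma nodePoly_derivative_eval (j : Fin n) : (derivative (nodePoly x)).eval (x j) =
    ∏ i ∈ Finset.univ.erase j, (x j - x i) := by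
  rw [nodePoly_eq_mul x j]
  simp [derivative_mul, eval_prod]

variable {x}

lemma nodePoly_derivative_eval_ne_zero (hx : Function.Injective x) (j : Fin n) :
    (derivative (nodePoly x)).eval (x j) ≠ 0 := by
  rw [nodePoly_derivative_eval]
  refine Finset.prod_ne_zero_iff.mpr fun i hi ↦ sub_ne_zero.mpr fun h ↦ ?_
  exact (Finset.ne_of_mem_erase hi) (hx h).symm

/-- With p = (X - x_j) g one has p' = g and p'' = 2g' at x_j, and g'/g is the sum of reciprocals.
This converts the interaction term of the system into p''/p'. -/
lemma nodePoly_derivative_derivative_eval (hx : Function.Injective x) (j : Fin n) :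
    (derivative (derivative (nodePoly x))).eval (x j) = 2 * (derivative (nodePoly x)).eval (x j) *
      ∑ i ∈ Finset.univ.erase j, 1 / (x j - x i) := by
  rw [nodePoly_derivative_eval, nodePoly_eq_mul x j]
  simp only [derivative_mul, derivative_sub, derivative_X, derivative_C, sub_zero, one_mul,
    derivative_add, eval_add, eval_mul, eval_sub, eval_X, eval_C, sub_self, zero_mul, add_zero]
  rw [derivative_prod_finset]
  simp only [derivative_sub, derivative_X, derivative_C, sub_zero, mul_one, eval_finsetSum,
    eval_prod, eval_sub, eval_X, eval_C]
  rw [← two_mul, mul_assoc]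
  congr 1
  rw [Finset.mul_sum]
  refine Finset.sum_congr rfl fun i hi ↦ ?_
  have : x j - x i ≠ 0 :=
    sub_ne_zero.mpr fun h ↦ (Finset.ne_of_mem_erase hi) (hx h).symm
  rw [← Finset.mul_prod_erase _ (fun i ↦ x j - x i) hi]
  field_simp

lemma nodePoly_dvd_of_eval_eq_zero (hx : Function.Injective x) {q : ℂ[X]}
    (h : ∀ j, q.eval (x j) = 0) : nodePoly x ∣ q :=
  Finset.prod_dvd_of_coprime (fun _ _ _ _ hij ↦ pairwise_coprime_X_sub_C hx hij)
    fun j _ ↦ dvd_iff_isRoot.mpr (h j)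

/-- The operator is triangular in the monomial basis, with diagonal entry m(m + 7/6), whence the
eigenvalue n(n + 7/6) for degree n. -/
lemma coeff_hypergeometric (p : ℂ[X]) (m : ℕ) :
    (X * (X - 1) * derivative (derivative p) + (C (13 / 6) * X - C (2 / 3)) * derivative p).coeff m
      = (m * (m - 1) + 13 / 6 * m) * p.coeff m - (m + 1) * (m + 2 / 3) * p.coeff (m + 1) := by
  have e : X * (X - 1) * derivative (derivative p) + (C (13 / 6) * X - C (2 / 3)) * derivative p =
      X * (X * derivative (derivative p)) - X * derivative (derivative p) +
        C (13 / 6) * (X * derivative p) - C (2 / 3) * derivative p := by ring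
  rw [e]
  rcases m with _ | _ | m
  · simp [coeff_derivative]
  · simp [coeff_derivative]
    ring
  · simp [coeff_derivative]
    ring

/-- The node polynomial of a solution of the system satisfies a hypergeometric equation. -/
lemma nodePoly_hypergeometric (hx : Function.Injective x) (h0 : ∀ j, x j ≠ 0 ∧ x j ≠ 1)
    (hsys : ∀ j, 4 / x j + 9 / (x j - 1) + ∑ i ∈ Finset.univ.erase j, 12 / (x j - x i) = 0) :
    X * (X - 1) * derivative (derivative (nodePoly x)) +
      (C (13 / 6) * X - C (2 / 3)) * derivative (nodePoly x) =
        C ((n : ℂ) * (n + 7 / 6)) * nodePoly x := by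
  rw [← sub_eq_zero]
  -- The choice of eigenvalue kills the coefficient of degree n. What remains has degree below n and
  -- vanishes at n distinct nodes, so it is zero.
  have hcoeff : ∀ m, n ≤ m → (X * (X - 1) * derivative (derivative (nodePoly x)) +
      (C (13 / 6) * X - C (2 / 3)) * derivative (nodePoly x) -
        C ((n : ℂ) * (n + 7 / 6)) * nodePoly x).coeff m = 0 := by
    intro m hm
    have h1 : (nodePoly x).coeff (m + 1) = 0 :=
      coeff_eq_zero_of_natDegree_lt (by rw [nodePoly_natDegree]; lia)
    rw [coeff_sub, coeff_hypergeometric, coeff_C_mul, h1]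
    rcases hm.eq_or_lt with rfl | hm
    · ring
    · rw [coeff_eq_zero_of_natDegree_lt (by rwa [nodePoly_natDegree])]
      ring
  refine Polynomial.eq_zero_of_degree_lt_of_eval_index_eq_zero Finset.univ (v := x) hx.injOn ?_
    fun j _ ↦ ?_
  · rw [Finset.card_univ, Fintype.card_fin]
    exact (degree_lt_iff_coeff_zero _ _).mpr hcoeff
  · have hs := hsys j
    obtain ⟨hx0, hx1⟩ := h0 j
    have hx1' : x j - 1 ≠ 0 := sub_ne_zero.mpr hx1
    have hsum : ∑ i ∈ Finset.univ.erase j, 12 / (x j - x i) =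
        12 * ∑ i ∈ Finset.univ.erase j, 1 / (x j - x i) := by
      rw [Finset.mul_sum]
      exact Finset.sum_congr rfl fun i _ ↦ by ring
    rw [hsum] at hs
    simp only [eval_sub, eval_add, eval_mul, eval_X, eval_one, eval_C, nodePoly_eval_node,
      nodePoly_derivative_derivative_eval hx]
    field_simp at hs
    -- With denominators cleared, the system reads 12x(x-1)Σ + 13x - 4 = 0 at x = x_j; division by 6
    -- gives the coefficients 13/6 and 2/3.
    linear_combination (derivative (nodePoly x)).eval (x j) / 6 * hs

/-- The hypergeometric operator plus 1/3 factors as (2/3 + X d/dX)(1/2 + (X - 1) d/dX), and the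
second factor sends p to its companion. -/
lemma nodeCompanion_ode (hx : Function.Injective x) (h0 : ∀ j, x j ≠ 0 ∧ x j ≠ 1)
    (hsys : ∀ j, 4 / x j + 9 / (x j - 1) + ∑ i ∈ Finset.univ.erase j, 12 / (x j - x i) = 0) :
    C (2 / 3) * nodeCompanion x + X * derivative (nodeCompanion x) =
      C ((n : ℂ) * (n + 7 / 6) + 1 / 3) * nodePoly x := by
  have h := nodePoly_hypergeometric hx h0 hsys
  have e1 : (C (13 / 6 : ℂ)) = C (2 / 3) + C (1 / 2) + 1 := by
    rw [← C_1, ← C_add, ← C_add]; norm_num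
  have e2 : (C (1 / 3 : ℂ)) = C (2 / 3) * C (1 / 2) := by rw [← C_mul]; norm_num
  rw [C_add, e2, add_mul, ← h, e1]
  simp only [nodeCompanion, derivative_add, derivative_mul, derivative_sub, derivative_X,
    derivative_C, derivative_one]
  ring

/-- A polynomial `L` for which the Wronskian-type expression below is constant modulo
`(X - 1) p ^ 2`. -/
lemma exists_interpolating_poly (hx : Function.Injective x) (h0 : ∀ j, x j ≠ 0 ∧ x j ≠ 1)
    (hsys : ∀ j, 4 / x j + 9 / (x j - 1) + ∑ i ∈ Finset.univ.erase j, 12 / (x j - x i) = 0) :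
    ∃ L v : ℂ[X], X * L * nodeCompanion x -
      (X - 1) * nodePoly x * (C (1 / 3) * L + X * derivative L) =
        1 + (X - 1) * nodePoly x ^ 2 * v := by
  have hode := nodeCompanion_ode hx h0 hsys
  have hp1 : (nodePoly x).eval 1 ≠ 0 := by
    rw [nodePoly_eval]
    exact Finset.prod_ne_zero_iff.mpr fun i _ ↦ sub_ne_zero.mpr (h0 i).2.symm
  -- The values are forced: p = 0 and s = (X - 1)p' at x_j, while s = p/2 at 1, so X L s = 1 at all
  -- these points.
  obtain ⟨L, hL1, hLx⟩ : ∃ L : ℂ[X], L.eval 1 = 2 / (nodePoly x).eval 1 ∧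
      ∀ j, L.eval (x j) = 1 / (x j * (x j - 1) * (derivative (nodePoly x)).eval (x j)) := by
    let t : Option (Fin n) → ℂ := fun o ↦ o.elim 1 x
    let r : Option (Fin n) → ℂ := fun o ↦ o.elim (2 / (nodePoly x).eval 1)
      fun j ↦ 1 / (x j * (x j - 1) * (derivative (nodePoly x)).eval (x j))
    have ht : Function.Injective t := by
      rintro (_ | i) (_ | j) h
      · rfl
      · exact absurd h.symm (h0 j).2
      · exact absurd h (h0 i).2
      · exact congrArg some (hx h)
    refine ⟨Lagrange.interpolate Finset.univ t r, ?_, fun j ↦ ?_⟩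
    · exact Lagrange.eval_interpolate_at_node r ht.injOn (Finset.mem_univ none)
    · exact Lagrange.eval_interpolate_at_node r ht.injOn (Finset.mem_univ (some j))
  set p := nodePoly x with hp
  set s := nodeCompanion x with hs
  set M : ℂ[X] := X * L * s - (X - 1) * p * (C (1 / 3) * L + X * derivative L) - 1 with hM
  have hsx (j) : s.eval (x j) = (x j - 1) * (derivative p).eval (x j) := by
    simp [hs, nodeCompanion, ← hp, hp ▸ nodePoly_eval_node x j]
  have hMx (j) : M.eval (x j) = 0 := by
    have h1 : x j - 1 ≠ 0 := sub_ne_zero.mpr (h0 j).2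
    have h2 := nodePoly_derivative_eval_ne_zero hx j
    have h3 := (h0 j).1
    simp only [hM, eval_sub, eval_mul, eval_X, eval_one, hsx, hLx, hp ▸ nodePoly_eval_node x j]
    rw [← hp] at h2
    field_simp
    simp
  have hM1 : M.eval 1 = 0 := by
    simp [hM, hs, nodeCompanion, ← hp, hL1]
    field_simp
    simp
  -- The double zero imposes nothing further on L: at x_j the L' terms cancel, leaving L (2/3 s + X
  -- s'), which is zero by `nodeCompanion_ode`.
  have hM' (j) : (derivative M).eval (x j) = 0 := by
    have h1 := congrArg (eval (x j)) hode
    have h2 : p.eval (x j) = 0 := hp ▸ nodePoly_eval_node x j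
    simp only [eval_add, eval_mul, eval_C, eval_X, h2, mul_zero, hsx] at h1
    simp only [hM, derivative_sub, derivative_mul, derivative_add, derivative_X, derivative_C,
      derivative_one, eval_add, eval_sub, eval_mul, eval_C, eval_X, eval_one, h2, hsx]
    simp only [eval_zero]
    linear_combination L.eval (x j) * h1
  obtain ⟨T, hT⟩ := nodePoly_dvd_of_eval_eq_zero hx hMx
  have hTx (j) : T.eval (x j) = 0 := by
    have h1 := hM' j
    rw [hT, derivative_mul, eval_add, eval_mul, eval_mul, nodePoly_eval_node, zero_mul,
      add_zero] at h1
    exact (mul_eq_zero.mp h1).resolve_left (nodePoly_derivative_eval_ne_zero hx j)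
  obtain ⟨U, hU⟩ := nodePoly_dvd_of_eval_eq_zero hx hTx
  have hU1 : U.eval 1 = 0 := by
    rw [hT, hU, eval_mul, eval_mul] at hM1
    exact ((mul_eq_zero.mp hM1).resolve_left hp1 |> mul_eq_zero.mp).resolve_left hp1
  obtain ⟨v, hv⟩ := dvd_iff_isRoot.mpr hU1
  refine ⟨L, v, ?_⟩
  rw [hU, hv, ← hp] at hT
  rw [C_1] at hT
  linear_combination hT

end StieltjesBethe

/-! ### Scaling of level one forms, and Eisenstein sums of scaled lattices. -/

section ScaledPeriods

/-- Level one modular forms scale with their weight as soon as `E₄` and `E₆` do. -/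
lemma ModularForm.apply_eq_pow_mul_of_E₄_of_E₆ {τ w : ℍ} {l : ℂ}
    (h4 : ModularForm.E₄ w = l ^ 4 * ModularForm.E₄ τ)
    (h6 : ModularForm.E₆ w = l ^ 6 * ModularForm.E₆ τ) (k : ℕ) (F : ModularForm 𝒮ℒ k) :
    F w = l ^ k * F τ := by
  have hΔ : ModularForm.discriminant w = l ^ 12 * ModularForm.discriminant τ := by
    rw [ModularForm.discriminant_eq_E₄_cube_sub_E₆_sq, ModularForm.discriminant_eq_E₄_cube_sub_E₆_sq,
      h4, h6]
    ring
  induction k using Nat.strong_induction_on with | _ k ih =>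
  rcases Nat.even_or_odd k with hk | hk
  swap
  · rw [ModularForm.levelOne_odd_weight_eq_zero (mod_cast hk) F]
    simp
  rcases Nat.lt_or_ge k 3 with hk3 | hk3
  · interval_cases k
    · obtain ⟨c, hc⟩ := ModularFormClass.levelOne_weight_zero_const (F := ModularForm 𝒮ℒ 0) F
      have h (z : ℍ) : F z = c := congrFun hc z
      rw [h, h, pow_zero, one_mul]
    · exact absurd hk (by decide)
    · have h0 : F = 0 := rank_zero_iff_forall_zero.mp ModularForm.levelOne_weight_two_rank_zero F
      simp [h0]
  obtain ⟨a, b, hab⟩ : ∃ a b : ℕ, k = 4 * a + 6 * b := by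
    obtain ⟨m, rfl⟩ := hk
    rcases Nat.even_or_odd m with ⟨r, rfl⟩ | ⟨r, rfl⟩
    · exact ⟨r, 0, by lia⟩
    · exact ⟨r - 1, 1, by lia⟩
  let G : ModularForm 𝒮ℒ k := ModularForm.mcast (by rw [hab]; push_cast; ring)
    ((ModularForm.E₄.pow a).mul (ModularForm.E₆.pow b))
  have hG (z : ℍ) : G z = ModularForm.E₄ z ^ a * ModularForm.E₆ z ^ b := by
    simp [G, ModularForm.mcast_apply]
  have hG0 : (qExpansion 1 G).coeff 0 = 1 := by
    have h4 := EisensteinSeries.E_qExpansion_coeff_zero (k := 4) (by norm_num) ⟨2, rfl⟩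
    have h6 := EisensteinSeries.E_qExpansion_coeff_zero (k := 6) (by norm_num) ⟨3, rfl⟩
    rw [show qExpansion 1 G = qExpansion 1 ((ModularForm.E₄.pow a).mul (ModularForm.E₆.pow b)) from
      rfl, ModularForm.qExpansion_mul one_pos one_mem_strictPeriods_SL,
      ModularForm.qExpansion_pow one_pos one_mem_strictPeriods_SL,
      ModularForm.qExpansion_pow one_pos one_mem_strictPeriods_SL]
    simp only [PowerSeries.coeff_zero_eq_constantCoeff, map_mul, map_pow] at h4 h6 ⊢
    simp [h4, h6]
  -- Subtracting c E₄^a E₆^b leaves a cusp form; its quotient by Δ has weight k - 12, where the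
  -- induction hypothesis applies, or is zero when k < 12.
  set c := (qExpansion 1 F).coeff 0 with hc
  have h0 : (qExpansion 1 (F - c • G : ModularForm 𝒮ℒ k)).coeff 0 = 0 := by
    rw [FunLike.coe_sub, ModularForm.qExpansion_sub one_pos one_mem_strictPeriods_SL,
      FunLike.coe_smul, ModularForm.qExpansion_smul one_pos one_mem_strictPeriods_SL, map_sub,
      PowerSeries.coeff_smul, hG0, ← hc]
    simp
  have hval (z : ℍ) : F z = c * G z + ModularForm.discriminant z *
      CuspForm.discriminantEquiv (ModularForm.toCuspForm (F - c • G) h0) z := by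
    rw [ModularForm.discriminant_mul_discriminantEquiv_apply, ModularForm.toCuspForm_apply]
    simp
  have hsub : CuspForm.discriminantEquiv (ModularForm.toCuspForm (F - c • G) h0) w * l ^ 12 =
      l ^ k * CuspForm.discriminantEquiv (ModularForm.toCuspForm (F - c • G) h0) τ := by
    rcases Nat.lt_or_ge k 12 with hk12 | hk12
    · have : CuspForm.discriminantEquiv (ModularForm.toCuspForm (F - c • G) h0) = 0 :=
        rank_zero_iff_forall_zero.mp (ModularForm.levelOne_neg_weight_rank_zero (by lia)) _
      simp [this]
    · have := ih (k - 12) (by lia) (ModularForm.mcast (by lia)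
        (CuspForm.discriminantEquiv (ModularForm.toCuspForm (F - c • G) h0)))
      rw [ModularForm.mcast_apply, ModularForm.mcast_apply] at this
      rw [this, show l ^ k = l ^ (k - 12) * l ^ 12 by rw [← pow_add]; congr 1; lia]
      ring
  rw [hval w, hval τ, hG, hG, h4, h6, hΔ]
  have hlk : l ^ k = (l ^ 4) ^ a * (l ^ 6) ^ b := by
    rw [← pow_mul, ← pow_mul, ← pow_add, ← hab]
  rw [mul_pow, mul_pow]
  linear_combination ModularForm.discriminant τ * hsub -
    c * ModularForm.E₄ τ ^ a * ModularForm.E₆ τ ^ b * hlk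

/-- The pair of periods `(μ τ, μ)`. -/
noncomputable def scaledPeriodPair (τ : ℍ) (μ : ℂ) (hμ : μ ≠ 0) : PeriodPair where
  ω₁ := μ * τ
  ω₂ := μ
  indep := by
    rw [LinearIndependent.pair_iff]
    intro s t h
    have h1 : (s : ℂ) * τ + t = 0 := by
      have : μ * ((s : ℂ) * τ + t) = 0 := by
        rw [← h]
        simp only [Complex.real_smul]
        ring
      exact (mul_eq_zero.mp this).resolve_left hμ
    have h2 : s = 0 := by
      have := congrArg Complex.im h1
      simpa [τ.im_ne_zero] using this
    subst h2
    simpa using h1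

lemma mem_scaledPeriodPair_lattice {τ : ℍ} {μ : ℂ} {hμ : μ ≠ 0} {z : ℂ} :
    z ∈ (scaledPeriodPair τ μ hμ).lattice ↔ ∃ a b : ℤ, μ * (a * τ + b) = z := by
  rw [PeriodPair.mem_lattice]
  refine exists₂_congr fun a b ↦ ?_
  rw [show (scaledPeriodPair τ μ hμ).ω₁ = μ * τ from rfl,
    show (scaledPeriodPair τ μ hμ).ω₂ = μ from rfl]
  ring_nf

lemma scaledPeriodPair_G (τ : ℍ) (μ : ℂ) (hμ : μ ≠ 0) {k : ℕ} (hk : 3 ≤ k) :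
    (scaledPeriodPair τ μ hμ).G k =
      (μ ^ k)⁻¹ * (2 * riemannZeta k * ModularForm.E hk τ) := by
  have h1 := tsum_eisSummand_eq_riemannZeta_mul_eisensteinSeries hk τ
  have h2 : ModularForm.E hk τ = 1 / 2 * eisensteinSeries (N := 1) 0 k τ := rfl
  have h3 : 2 * riemannZeta k * ModularForm.E hk τ =
      ∑' v : Fin 2 → ℤ, EisensteinSeries.eisSummand k v τ := by
    rw [h1, h2]
    ring
  rw [h3, PeriodPair.G, ← tsum_mul_left,
    ← (scaledPeriodPair τ μ hμ).latticeEquivProd.symm.toEquiv.tsum_eq,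
    ← (finTwoArrowEquiv ℤ).tsum_eq]
  refine tsum_congr fun v ↦ ?_
  have : (((scaledPeriodPair τ μ hμ).latticeEquivProd.symm (v 0, v 1) :
      (scaledPeriodPair τ μ hμ).lattice) : ℂ) = μ * (v 0 * τ + v 1) := by
    rw [PeriodPair.latticeEquiv_symm_apply, show (scaledPeriodPair τ μ hμ).ω₁ = μ * τ from rfl,
      show (scaledPeriodPair τ μ hμ).ω₂ = μ from rfl]
    ring
  change ((((scaledPeriodPair τ μ hμ).latticeEquivProd.symm (v 0, v 1) :
      (scaledPeriodPair τ μ hμ).lattice) : ℂ) ^ k)⁻¹ = _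
  rw [this, mul_pow, mul_inv, EisensteinSeries.eisSummand, zpow_neg, zpow_natCast]

end ScaledPeriods

/-! ### A lattice is determined by its Eisenstein sums. -/

namespace PeriodPair

lemma countable_lattice (L : PeriodPair) : (L.lattice : Set ℂ).Countable := by
  have : Countable L.lattice := L.latticeEquivProd.toEquiv.countable_iff.mpr inferInstance
  exact Set.to_countable _

lemma weierstrassP_eq_weierstrassPExcept_zero_add (L : PeriodPair) (z : ℂ) :
    L.weierstrassP z = L.weierstrassPExcept 0 z + 1 / z ^ 2 := by
  simpa using (L.weierstrassPExcept_add 0 z).symm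

/-- The Taylor coefficients of ℘ - 1/z² at 0 are (i + 1) G_{i+2} for i ≥ 1, and the constant term is
0. -/
lemma weierstrassPExcept_zero_eventuallyEq {L₁ L₂ : PeriodPair}
    (hG : ∀ k, 3 ≤ k → L₁.G k = L₂.G k) :
    L₁.weierstrassPExcept 0 =ᶠ[𝓝 0] L₂.weierstrassPExcept 0 := by
  have h1 := L₁.hasFPowerSeriesAt_weierstrassPExcept 0
  have h2 := L₂.hasFPowerSeriesAt_weierstrassPExcept 0
  have : (fun i : ℕ ↦ if i = 0 then L₁.weierstrassPExcept 0 0 else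
        (i + 1) * L₁.sumInvPow 0 (i + 2)) =
      fun i : ℕ ↦ if i = 0 then L₂.weierstrassPExcept 0 0 else
        (i + 1) * L₂.sumInvPow 0 (i + 2) := by
    ext i
    rcases i with _ | i
    · simp
    · simp only [sumInvPow_zero, hG (i + 1 + 2) (by lia)]
      simp
  rw [this] at h1
  exact (h1.eventually_hasSum_sub.and h2.eventually_hasSum_sub).mono fun z h ↦ h.1.unique h.2

/-- The lattice is the set of poles of ℘. The two ℘-functions agree near 0, hence off both lattices,
since the complement of a countable set in the plane is connected. A point of one lattice outside
the other would be a pole of only one of them. -/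
lemma lattice_le_of_G_eq {L₁ L₂ : PeriodPair} (hG : ∀ k, 3 ≤ k → L₁.G k = L₂.G k) :
    L₁.lattice ≤ L₂.lattice := by
  intro l hl
  by_contra hl2
  let U : Set ℂ := ((L₁.lattice : Set ℂ) ∪ L₂.lattice)ᶜ
  have hUc : ((L₁.lattice : Set ℂ) ∪ L₂.lattice).Countable :=
    L₁.countable_lattice.union L₂.countable_lattice
  have hconn : IsPreconnected U :=
    (hUc.isConnected_compl_of_one_lt_rank (by simp [Complex.rank_real_complex])).isPreconnected
  have hUo : IsOpen U := (L₁.isClosed_lattice.union L₂.isClosed_lattice).isOpen_compl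
  have hdense : Dense U := hUc.dense_compl ℂ
  have hA1 : AnalyticOnNhd ℂ L₁.weierstrassP U :=
    L₁.analyticOnNhd_weierstrassP.mono fun z hz h ↦ hz (.inl h)
  have hA2 : AnalyticOnNhd ℂ L₂.weierstrassP U :=
    L₂.analyticOnNhd_weierstrassP.mono fun z hz h ↦ hz (.inr h)
  have hnear : L₁.weierstrassP =ᶠ[𝓝 0] L₂.weierstrassP :=
    (weierstrassPExcept_zero_eventuallyEq hG).mono fun z hz ↦ by
      rw [weierstrassP_eq_weierstrassPExcept_zero_add, hz,
        weierstrassP_eq_weierstrassPExcept_zero_add]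
  obtain ⟨V, hV, hVo, hV0⟩ := eventually_nhds_iff.mp hnear
  -- The origin lies in both lattices, so the identity theorem has to start from a nearby point.
  obtain ⟨z₀, hz₀V, hz₀U⟩ := hdense.inter_open_nonempty V hVo ⟨0, hV0⟩
  have hEq : Set.EqOn L₁.weierstrassP L₂.weierstrassP U :=
    hA1.eqOn_of_preconnected_of_eventuallyEq hA2 hconn hz₀U
      (eventually_nhds_iff.mpr ⟨V, hV, hVo, hz₀V⟩)
  have hev : L₁.weierstrassP =ᶠ[𝓝[≠] l] L₂.weierstrassP := by
    filter_upwards [self_mem_nhdsWithin, mem_nhdsWithin_of_mem_nhds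
      (L₁.compl_lattice_sdiff_singleton_mem_nhds l), mem_nhdsWithin_of_mem_nhds
      (L₂.isClosed_lattice.isOpen_compl.mem_nhds hl2)] with z hz hz1 hz2
    refine hEq ?_
    rintro (h | h)
    · exact hz1 ⟨h, hz⟩
    · exact hz2 h
  have h1 := L₁.order_weierstrassP l hl
  rw [meromorphicOrderAt_congr hev] at h1
  have h2 := (L₂.analyticOnNhd_weierstrassP l hl2).meromorphicOrderAt_nonneg
  rw [h1] at h2
  exact absurd h2 (by decide)

end PeriodPair

/-! ### Injectivity of J modulo SL(2, ℤ). -/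

open ModularForm in
lemma E₄_E₆_not_both_zero (τ : ℍ) (h4 : E₄ τ = 0) : E₆ τ ≠ 0 := by
  intro h6
  have := discriminant_eq_E₄_cube_sub_E₆_sq τ
  rw [h4, h6] at this
  exact discriminant_ne_zero τ (by simpa using this)

open ModularForm in
lemma kleinJ_sub_one (τ : ℍ) : kleinJ τ - 1 = E₆ τ ^ 2 / (1728 * discriminant τ) := by
  have h := discriminant_eq_E₄_cube_sub_E₆_sq τ
  have hΔ := discriminant_ne_zero τ
  rw [kleinJ]
  field_simp
  linear_combination -1728 * h

open ModularForm in
/-- Two points with the same `J` differ by a scaling of the values of `E₄` and `E₆`. -/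
lemma exists_scaling_of_kleinJ_eq {τ w : ℍ} (h : kleinJ τ = kleinJ w) :
    ∃ l : ℂ, l ≠ 0 ∧ E₄ w = l ^ 4 * E₄ τ ∧ E₆ w = l ^ 6 * E₆ τ := by
  have hΔτ := discriminant_ne_zero τ
  have hΔw := discriminant_ne_zero w
  have h3 : E₄ τ ^ 3 * discriminant w = E₄ w ^ 3 * discriminant τ := by
    have := h
    rw [kleinJ, kleinJ] at this
    field_simp at this
    linear_combination this
  have h2 : E₆ τ ^ 2 * discriminant w = E₆ w ^ 2 * discriminant τ := by
    have : kleinJ τ - 1 = kleinJ w - 1 := by rw [h]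
    rw [kleinJ_sub_one, kleinJ_sub_one] at this
    field_simp at this
    linear_combination this
  by_cases h4 : E₄ τ = 0
  · have h4w : E₄ w = 0 := by
      rw [h4] at h3
      simpa [hΔτ] using h3.symm
    have h6 := E₄_E₆_not_both_zero τ h4
    have h6w := E₄_E₆_not_both_zero w h4w
    obtain ⟨l, hl⟩ := IsAlgClosed.exists_pow_nat_eq (E₆ w / E₆ τ) (n := 6) (by norm_num)
    refine ⟨l, ?_, by simp [h4, h4w], by rw [hl, div_mul_cancel₀ _ h6]⟩
    rintro rfl
    rw [zero_pow (by norm_num)] at hl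
    exact div_ne_zero h6w h6 hl.symm
  have h4w : E₄ w ≠ 0 := fun h0 ↦ by
    rw [h0] at h3
    simp [hΔw, h4] at h3
  by_cases h6 : E₆ τ = 0
  · have h6w : E₆ w = 0 := by
      rw [h6] at h2
      simpa [hΔτ] using h2.symm
    obtain ⟨l, hl⟩ := IsAlgClosed.exists_pow_nat_eq (E₄ w / E₄ τ) (n := 4) (by norm_num)
    refine ⟨l, ?_, by rw [hl, div_mul_cancel₀ _ h4], by simp [h6, h6w]⟩
    rintro rfl
    rw [zero_pow (by norm_num)] at hl
    exact div_ne_zero h4w h4 hl.symm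
  have h6w : E₆ w ≠ 0 := fun h0 ↦ by
    rw [h0] at h2
    simp [hΔw, h6] at h2
  have h32 : E₄ τ ^ 3 * E₆ w ^ 2 = E₄ w ^ 3 * E₆ τ ^ 2 := by
    apply mul_right_cancel₀ (mul_ne_zero hΔτ hΔw)
    linear_combination E₆ w ^ 2 * discriminant τ * h3 - E₄ w ^ 3 * discriminant τ * h2
  -- As E₆/E₄ has weight 2, its ratio at the two points must be l²; the sign of l is immaterial for
  -- weights 4 and 6.
  obtain ⟨l, hl⟩ := IsAlgClosed.exists_pow_nat_eq (E₆ w * E₄ τ / (E₆ τ * E₄ w)) (n := 2)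
    (by norm_num)
  refine ⟨l, ?_, ?_, ?_⟩
  · rintro rfl
    rw [zero_pow (by norm_num)] at hl
    exact div_ne_zero (mul_ne_zero h6w h4) (mul_ne_zero h6 h4w) hl.symm
  · rw [show l ^ 4 = (l ^ 2) ^ 2 by ring, hl]
    field_simp
    linear_combination -h32
  · rw [show l ^ 6 = (l ^ 2) ^ 3 by ring, hl]
    field_simp
    linear_combination -h32

/-- The modular function `J` separates the orbits of `SL(2, ℤ)`. -/
lemma mem_orbit_of_kleinJ_eq {τ w : ℍ} (h : kleinJ τ = kleinJ w) :
    τ ∈ MulAction.orbit SL(2, ℤ) w := by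
  obtain ⟨l, hl, h4, h6⟩ := exists_scaling_of_kleinJ_eq h
  have hscale := ModularForm.apply_eq_pow_mul_of_E₄_of_E₆ h4 h6
  have hG (k : ℕ) (hk : 3 ≤ k) : (scaledPeriodPair w 1 one_ne_zero).G k =
      (scaledPeriodPair τ l⁻¹ (inv_ne_zero hl)).G k := by
    rw [scaledPeriodPair_G _ _ _ hk, scaledPeriodPair_G _ _ _ hk, hscale k (ModularForm.E hk),
      inv_pow, inv_inv]
    ring
  have hle := PeriodPair.lattice_le_of_G_eq hG
  have hge := PeriodPair.lattice_le_of_G_eq fun k hk ↦ (hG k hk).symm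
  -- `τ / l` and `1 / l` are integral combinations of `w` and `1`, and conversely
  obtain ⟨a, b, hab⟩ := mem_scaledPeriodPair_lattice.mp
    (hge (mem_scaledPeriodPair_lattice.mpr ⟨1, 0, rfl⟩))
  obtain ⟨c, d, hcd⟩ := mem_scaledPeriodPair_lattice.mp
    (hge (mem_scaledPeriodPair_lattice.mpr ⟨0, 1, rfl⟩))
  obtain ⟨a', b', hab'⟩ := mem_scaledPeriodPair_lattice.mp
    (hle (mem_scaledPeriodPair_lattice.mpr ⟨1, 0, rfl⟩))
  obtain ⟨c', d', hcd'⟩ := mem_scaledPeriodPair_lattice.mp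
    (hle (mem_scaledPeriodPair_lattice.mpr ⟨0, 1, rfl⟩))
  simp only [Int.cast_one, Int.cast_zero, one_mul, zero_mul, add_zero, zero_add, mul_one] at *
  have hτ : (τ : ℂ) = l * (a * w + b) := by rw [hab, mul_inv_cancel_left₀ hl]
  have h1 : 1 = l * (c * w + d) := by rw [hcd, mul_inv_cancel₀ hl]
  have hindep (m k : ℤ) (hmk : (m : ℂ) * w + k = 0) : m = 0 ∧ k = 0 := by
    have h2 := congrArg Complex.im hmk
    have h3 : m = 0 := by simpa [w.im_ne_zero] using h2
    subst h3
    exact ⟨rfl, by simpa using hmk⟩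
  obtain ⟨e1, e2⟩ := hindep (a' * a + b' * c - 1) (a' * b + b' * d) (by
    push_cast
    linear_combination hab' + a' * hab + b' * hcd)
  obtain ⟨e3, e4⟩ := hindep (c' * a + d' * c) (c' * b + d' * d - 1) (by
    push_cast
    linear_combination hcd' + c' * hab + d' * hcd)
  have hden : (c * w + d : ℂ) ≠ 0 := fun h0 ↦ by simp [h0] at h1
  have hτw : (τ : ℂ) = (a * w + b) / (c * w + d) := by
    rw [hτ, eq_div_iff hden]
    linear_combination -(a * w + b : ℂ) * h1
  have hdet : (a * d - b * c) * (a' * d' - b' * c') = 1 := by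
    linear_combination (c' * b + d' * d) * e1 + e4 - (c' * a + d' * c) * e2
  -- The base change between the lattices has determinant ±1; both points being in ℍ excludes -1.
  have hpos : 0 < a * d - b * c := by
    have him : (τ : ℂ).im = (a * d - b * c : ℤ) * w.im / Complex.normSq (c * w + d) := by
      rw [hτw, Complex.div_im]
      have := Complex.normSq_pos.mpr hden |>.ne'
      field_simp
      simp
      ring
    have h2 := τ.im_pos
    rw [← coe_im, him] at h2
    have h3 := (div_pos_iff_of_pos_right (Complex.normSq_pos.mpr hden)).mp h2
    exact_mod_cast (pos_iff_pos_of_mul_pos h3).mpr w.im_pos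
  have hone : a * d - b * c = 1 := by
    rcases Int.eq_one_or_neg_one_of_mul_eq_one hdet with h | h
    · exact h
    · lia
  let γ : SL(2, ℤ) := ⟨!![a, b; c, d], by rw [Matrix.det_fin_two_of, hone]⟩
  refine ⟨γ, UpperHalfPlane.ext ?_⟩
  change ((γ • w : ℍ) : ℂ) = τ
  rw [coe_specialLinearGroup_apply, hτw]
  simp [γ]

/-! ### The forms of weight -1 and their differential equations. -/

lemma kleinJ_mul_eta (τ : ℍ) :
    kleinJ τ * (1728 * ModularForm.eta τ ^ 24) = ModularForm.E₄ τ ^ 3 :=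
  div_mul_cancel₀ _ (mul_ne_zero (by norm_num) (pow_ne_zero 24 (ModularForm.eta_ne_zero τ.2)))

lemma kleinJ_sub_one_mul_eta (τ : ℍ) :
    (kleinJ τ - 1) * (1728 * ModularForm.eta τ ^ 24) = ModularForm.E₆ τ ^ 2 := by
  rw [kleinJ_sub_one]
  exact div_mul_cancel₀ _
    (mul_ne_zero (by norm_num) (pow_ne_zero 24 (ModularForm.eta_ne_zero τ.2)))

lemma hasDerivAt_eta_comp_ofComplex (τ : ℍ) :
    HasDerivAt (fun z : ℂ ↦ ModularForm.eta (ofComplex z))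
      (2 * Real.pi * Complex.I * (EisensteinSeries.E2 τ / 24 * ModularForm.eta τ)) τ := by
  refine (hasDerivAt_eta τ).congr_of_eventuallyEq ?_
  filter_upwards [isOpen_upperHalfPlaneSet.mem_nhds τ.im_pos] with z hz
  rw [ofComplex_apply_of_im_pos hz]

lemma hasDerivAt_eval_kleinJ (q : Polynomial ℂ) (τ : ℍ) :
    HasDerivAt (fun z : ℂ ↦ q.eval (kleinJ (ofComplex z)))
      (q.derivative.eval (kleinJ τ) * (2 * Real.pi * Complex.I *
        -(ModularForm.E₄ τ ^ 2 * ModularForm.E₆ τ / (1728 * ModularForm.eta τ ^ 24)))) τ := by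
  have h : HasDerivAt (fun y : ℂ ↦ q.eval y) (q.derivative.eval (kleinJ τ))
      ((kleinJ ∘ ofComplex) τ) := by
    rw [Function.comp_apply, ofComplex_apply]
    exact q.hasDerivAt _
  exact h.comp (τ : ℂ) (hasDerivAt_kleinJ τ)

section Forms

variable {n : ℕ} (x : Fin n → ℂ)

/-- The holomorphic form `E₆ p(J) / η ^ 14` of weight `-1`, where `p` has the roots `x i`. -/
noncomputable def nodeForm (τ : ℍ) : ℂ :=
  ModularForm.E₆ τ * (nodePoly x).eval (kleinJ τ) / ModularForm.eta τ ^ 14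

/-- Minus the Serre derivative of `nodeForm`. -/
noncomputable def nodeFormSerre (τ : ℍ) : ℂ :=
  ModularForm.E₄ τ ^ 2 * (nodeCompanion x).eval (kleinJ τ) / ModularForm.eta τ ^ 14

/-- The holomorphic form `E₄ L(J) / η ^ 10` of weight `-1`. -/
noncomputable def auxForm (L : Polynomial ℂ) (τ : ℍ) : ℂ :=
  ModularForm.E₄ τ * L.eval (kleinJ τ) / ModularForm.eta τ ^ 10

/-- The companion p/2 + (X - 1)p' arises here: 1/2 from Ramanujan's formula for E₆, and J - 1 from
E₆² = 1728 (J - 1) η^24. -/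
lemma hasDerivAt_nodeForm (τ : ℍ) : HasDerivAt (nodeForm x ∘ ofComplex)
    (2 * Real.pi * Complex.I *
      (-nodeFormSerre x τ - EisensteinSeries.E2 τ / 12 * nodeForm x τ)) τ := by
  have hη : ModularForm.eta τ ≠ 0 := ModularForm.eta_ne_zero τ.2
  have hη' : ModularForm.eta (ofComplex τ) ≠ 0 := by rwa [ofComplex_apply]
  have h := ((hasDerivAt_E₆ τ).fun_mul (hasDerivAt_eval_kleinJ (nodePoly x) τ)).fun_div
    ((hasDerivAt_eta_comp_ofComplex τ).fun_pow 14) (pow_ne_zero 14 hη')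
  refine h.congr_deriv ?_
  have hJ := kleinJ_sub_one_mul_eta τ
  simp only [Function.comp_apply, ofComplex_apply, nodeForm, nodeFormSerre, nodeCompanion,
    Polynomial.eval_add, Polynomial.eval_mul, Polynomial.eval_sub, Polynomial.eval_X,
    Polynomial.eval_one, Polynomial.eval_C]
  field_simp
  linear_combination 576 * ModularForm.E₄ τ ^ 2 *
    (nodePoly x).derivative.eval (kleinJ τ) * hJ

/-- Here 2/3 comes from differentiating E₄², and the factor J from E₄³ = 1728 J η^24. The last
bracket is the left side of `nodeCompanion_ode` at J. -/
lemma hasDerivAt_nodeFormSerre (τ : ℍ) : HasDerivAt (nodeFormSerre x ∘ ofComplex)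
    (2 * Real.pi * Complex.I * (EisensteinSeries.E2 τ / 12 * nodeFormSerre x τ -
      ModularForm.E₆ τ * ModularForm.E₄ τ / ModularForm.eta τ ^ 14 *
      (2 / 3 * (nodeCompanion x).eval (kleinJ τ) +
        kleinJ τ * (nodeCompanion x).derivative.eval (kleinJ τ)))) τ := by
  have hη : ModularForm.eta τ ≠ 0 := ModularForm.eta_ne_zero τ.2
  have hη' : ModularForm.eta (ofComplex τ) ≠ 0 := by rwa [ofComplex_apply]
  have h := (((hasDerivAt_E₄ τ).fun_pow 2).fun_mul
    (hasDerivAt_eval_kleinJ (nodeCompanion x) τ)).fun_div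
    ((hasDerivAt_eta_comp_ofComplex τ).fun_pow 14) (pow_ne_zero 14 hη')
  refine h.congr_deriv ?_
  have hJ := kleinJ_mul_eta τ
  simp only [Function.comp_apply, ofComplex_apply, nodeFormSerre]
  field_simp
  linear_combination 864 * ModularForm.E₄ τ * ModularForm.E₆ τ *
    (nodeCompanion x).derivative.eval (kleinJ τ) * hJ

lemma hasDerivAt_auxForm (L : Polynomial ℂ) (τ : ℍ) : HasDerivAt (auxForm L ∘ ofComplex)
    (2 * Real.pi * Complex.I * (-(ModularForm.E₆ τ / ModularForm.eta τ ^ 10 *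
      (1 / 3 * L.eval (kleinJ τ) + kleinJ τ * L.derivative.eval (kleinJ τ))) -
        EisensteinSeries.E2 τ / 12 * auxForm L τ)) τ := by
  have hη : ModularForm.eta τ ≠ 0 := ModularForm.eta_ne_zero τ.2
  have hη' : ModularForm.eta (ofComplex τ) ≠ 0 := by rwa [ofComplex_apply]
  have h := ((hasDerivAt_E₄ τ).fun_mul (hasDerivAt_eval_kleinJ L τ)).fun_div
    ((hasDerivAt_eta_comp_ofComplex τ).fun_pow 10) (pow_ne_zero 10 hη')
  refine h.congr_deriv ?_
  have hJ := kleinJ_mul_eta τ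
  simp only [Function.comp_apply, ofComplex_apply, auxForm]
  field_simp
  linear_combination 864 * ModularForm.E₆ τ * L.derivative.eval (kleinJ τ) * hJ

variable {x}

/-- The linear differential equation of second order satisfied by `nodeForm`. -/
lemma hasDerivAt_deriv_nodeForm (hx : Function.Injective x) (h0 : ∀ j, x j ≠ 0 ∧ x j ≠ 1)
    (hsys : ∀ j, 4 / x j + 9 / (x j - 1) + ∑ i ∈ Finset.univ.erase j, 12 / (x j - x i) = 0)
    (τ : ℍ) : HasDerivAt (deriv (nodeForm x ∘ ofComplex))
      (-(Real.pi : ℂ) ^ 2 * ((12 * n + 7) / 6) ^ 2 * ModularForm.E₄ τ * nodeForm x τ) τ := by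
  have hE : deriv (nodeForm x ∘ ofComplex) =ᶠ[𝓝 (τ : ℂ)] fun z ↦ 2 * Real.pi * Complex.I *
      (-(nodeFormSerre x ∘ ofComplex) z -
        (EisensteinSeries.E2 ∘ ofComplex) z / 12 * (nodeForm x ∘ ofComplex) z) := by
    filter_upwards [isOpen_upperHalfPlaneSet.mem_nhds τ.im_pos] with z hz
    have := (hasDerivAt_nodeForm x ⟨z, hz⟩).deriv
    simpa [ofComplex_apply_of_im_pos hz] using this
  have h := (((hasDerivAt_nodeFormSerre x τ).fun_neg.fun_sub
    (((hasDerivAt_E2 τ).div_const 12).fun_mul (hasDerivAt_nodeForm x τ))).const_mul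
      (2 * Real.pi * Complex.I : ℂ)).congr_of_eventuallyEq hE
  refine h.congr_deriv ?_
  have hode := congrArg (Polynomial.eval (kleinJ τ)) (nodeCompanion_ode hx h0 hsys)
  simp only [Polynomial.eval_add, Polynomial.eval_mul, Polynomial.eval_X,
    Polynomial.eval_C] at hode
  simp only [Function.comp_apply, ofComplex_apply]
  rw [hode]
  have hN : ModularForm.E₆ τ * ModularForm.E₄ τ / ModularForm.eta τ ^ 14 *
      (((n : ℂ) * (n + 7 / 6) + 1 / 3) * (nodePoly x).eval (kleinJ τ)) =
      ((n : ℂ) * (n + 7 / 6) + 1 / 3) * ModularForm.E₄ τ * nodeForm x τ := by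
    rw [nodeForm]
    ring
  rw [hN]
  -- The E₂ terms cancel, and the derivative of E₂ contributes E₄/144: n(n + 7/6) + 1/3 + 1/144 = (n
  -- + 7/12)².
  linear_combination (Real.pi : ℂ) ^ 2 * ((12 * n + 7) / 6) ^ 2 * ModularForm.E₄ τ *
    nodeForm x τ * Complex.I_sq

end Forms

/-! ### Primitives on the half-plane. -/

/-- A holomorphic function on the upper half-plane has a holomorphic primitive there. -/
lemma exists_primitive_upperHalfPlane {g : ℂ → ℂ} (hg : DifferentiableOn ℂ g upperHalfPlaneSet) :
    ∃ H : ℂ → ℂ, ∀ z ∈ upperHalfPlaneSet, HasDerivAt H (g z) z := by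
  -- Discs tangent to the real axis at 0 increase to the whole half-plane. Primitives on them,
  -- normalized to vanish at i, agree on overlaps and glue.
  let B : ℕ → Set ℂ := fun N ↦ Metric.ball (((N + 1 : ℕ) : ℂ) * Complex.I) ((N + 1 : ℕ) : ℝ)
  have hmem (N : ℕ) (z : ℂ) : z ∈ B N ↔ z.re ^ 2 + z.im ^ 2 < 2 * (N + 1) * z.im := by
    rw [Metric.mem_ball, Complex.dist_eq, ← sq_lt_sq₀ (norm_nonneg _) (Nat.cast_nonneg _),
      Complex.sq_norm, Complex.normSq_apply]
    simp only [Complex.sub_re, Complex.mul_re, Complex.natCast_re, Complex.I_re, mul_zero,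
      Complex.natCast_im, Complex.I_im, mul_one, sub_self, sub_zero, Complex.sub_im, Complex.mul_im,
      add_zero]
    push_cast
    constructor <;> intro h <;> nlinarith
  have hsub (N : ℕ) : B N ⊆ upperHalfPlaneSet := fun z hz ↦ by
    rw [hmem] at hz
    by_contra hz'
    have : z.im ≤ 0 := not_lt.mp hz'
    nlinarith [sq_nonneg z.re, sq_nonneg z.im, mul_nonneg (Nat.cast_nonneg (α := ℝ) N)
      (neg_nonneg.mpr this)]
  have hmono {M N : ℕ} (h : M ≤ N) : B M ⊆ B N := fun z hz ↦ by
    have him : 0 < z.im := hsub M hz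
    rw [hmem] at hz ⊢
    have : (M : ℝ) ≤ N := Nat.cast_le.mpr h
    nlinarith
  have hcover (z : ℂ) (hz : z ∈ upperHalfPlaneSet) : ∃ N, z ∈ B N := by
    have him : 0 < z.im := hz
    obtain ⟨N, hN⟩ := exists_nat_gt ((z.re ^ 2 + z.im ^ 2) / z.im)
    refine ⟨N, ?_⟩
    rw [hmem]
    rw [div_lt_iff₀ him] at hN
    nlinarith
  have hI (N : ℕ) : Complex.I ∈ B N := by
    rw [hmem]
    simp
    linarith [Nat.cast_nonneg (α := ℝ) N]
  choose H hH0 hH using fun N ↦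
    (DifferentiableOn.isExactOn_ball (hg.mono (hsub N))).with_val_at Complex.I 0
  have hcompat {M N : ℕ} (h : M ≤ N) : Set.EqOn (H M) (H N) (B M) := by
    have hconv : Convex ℝ (B M) := convex_ball _ _
    refine IsOpen.eqOn_of_deriv_eq (𝕜 := ℂ) Metric.isOpen_ball hconv.isPreconnected
      (fun z hz ↦ (hH M z hz).differentiableAt.differentiableWithinAt)
      (fun z hz ↦ (hH N z (hmono h hz)).differentiableAt.differentiableWithinAt)
      (fun z hz ↦ ?_) (hI M) (by rw [hH0, hH0])
    rw [(hH M z hz).deriv, (hH N z (hmono h hz)).deriv]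
  classical
  let ind : ℂ → ℕ := fun z ↦ if hz : z ∈ upperHalfPlaneSet then (hcover z hz).choose else 0
  have hind (z : ℂ) (hz : z ∈ upperHalfPlaneSet) : z ∈ B (ind z) := by
    simp only [ind, dif_pos hz]
    exact (hcover z hz).choose_spec
  have hval (N : ℕ) (z : ℂ) (hz : z ∈ B N) : H (ind z) z = H N z := by
    rcases le_total (ind z) N with h | h
    · exact hcompat h (hind z (hsub N hz))
    · exact (hcompat h hz).symm
  refine ⟨fun z ↦ H (ind z) z, fun z hz ↦ ?_⟩
  refine (hH (ind z) z (hind z hz)).congr_of_eventuallyEq ?_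
  filter_upwards [Metric.isOpen_ball.mem_nhds (hind z hz)] with y hy using hval _ y hy

/-! ### Invariance of J and its level sets. -/

section Invariance

lemma apply_smul_of_slash_eq {k : ℤ} {F : ℍ → ℂ} {γ : SL(2, ℤ)} (h : F ∣[k] γ = F) (τ : ℍ) :
    F (γ • τ) = denom γ τ ^ k * F τ := by
  have h1 := congrFun h τ
  rw [ModularForm.SL_slash_apply] at h1
  rw [← h1, mul_comm, mul_assoc, ← zpow_add₀ (denom_ne_zero _ _)]
  simp

lemma kleinJ_smul (γ : SL(2, ℤ)) (τ : ℍ) : kleinJ (γ • τ) = kleinJ τ := by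
  have h4 : ModularForm.E₄ (γ • τ) = denom γ τ ^ (4 : ℤ) * ModularForm.E₄ τ :=
    apply_smul_of_slash_eq (slash_E (k := 4) (by norm_num) γ) τ
  have hΔ : ModularForm.discriminant (γ • τ) = denom γ τ ^ (12 : ℤ) * ModularForm.discriminant τ :=
    apply_smul_of_slash_eq (SlashInvariantForm.slash_action_generators_SL2Z ModularForm.discriminant_S_invariant
      ModularForm.discriminant_T_invariant γ) τ
  have hd : denom γ τ ≠ 0 := denom_ne_zero _ _
  have h := ModularForm.discriminant_ne_zero τ
  rw [kleinJ, kleinJ, h4, hΔ]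
  simp only [zpow_ofNat]
  field_simp

/-- S fixes i and i⁶ = -1, so E₆(i) = -E₆(i). -/
lemma E₆_I : ModularForm.E₆ UpperHalfPlane.I = 0 := by
  have h : ModularForm.E₆ (ModularGroup.S • UpperHalfPlane.I) =
      denom ModularGroup.S UpperHalfPlane.I ^ (6 : ℤ) * ModularForm.E₆ UpperHalfPlane.I :=
    apply_smul_of_slash_eq (slash_E (k := 6) (by norm_num) ModularGroup.S) UpperHalfPlane.I
  have hS : ModularGroup.S • UpperHalfPlane.I = UpperHalfPlane.I := by
    apply UpperHalfPlane.ext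
    rw [modular_S_smul]
    simp
  rw [hS, ModularGroup.denom_S] at h
  have h6 : (UpperHalfPlane.I : ℂ) ^ (6 : ℤ) = -1 := by
    rw [coe_I, zpow_ofNat, show Complex.I ^ 6 = (Complex.I ^ 2) ^ 3 by ring, Complex.I_sq]
    norm_num
  rw [h6] at h
  linear_combination h / 2

lemma kleinJ_eq_one_iff (τ : ℍ) : kleinJ τ = 1 ↔ ModularForm.E₆ τ = 0 := by
  rw [← sub_eq_zero, kleinJ_sub_one]
  simp [ModularForm.discriminant_ne_zero τ]

lemma mem_orbit_iff_kleinJ_eq {τ w : ℍ} :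
    τ ∈ MulAction.orbit SL(2, ℤ) w ↔ kleinJ τ = kleinJ w := by
  refine ⟨?_, mem_orbit_of_kleinJ_eq⟩
  rintro ⟨γ, rfl⟩
  exact kleinJ_smul γ w

end Invariance

/-! ### The character of η⁴. -/

section EtaCharacter

open ModularForm in
lemma eta_pow_four_slash_T : (fun τ : ℍ ↦ eta τ ^ 4) ∣[(2 : ℤ)] ModularGroup.T =
    Complex.exp (2 * Real.pi * Complex.I / 6) • fun τ : ℍ ↦ eta τ ^ 4 := by
  ext τ
  have hd : denom ModularGroup.T τ = 1 := by simp [denom, ModularGroup.coe_T]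
  have h1 (m : ℕ) : eta_q m ((1 : ℝ) + τ) = eta_q m τ := by
    simp only [eta_q, Function.Periodic.qParam]
    congr 1
    rw [show (2 * Real.pi * Complex.I * ((1 : ℝ) + τ) / (1 : ℝ) : ℂ) =
      2 * Real.pi * Complex.I * τ / (1 : ℝ) + 2 * Real.pi * Complex.I by push_cast; ring]
    exact Complex.exp_periodic _
  have h2 : Function.Periodic.qParam 24 ((1 : ℝ) + τ) ^ 4 =
      Complex.exp (2 * Real.pi * Complex.I / 6) * Function.Periodic.qParam 24 τ ^ 4 := by
    simp only [Function.Periodic.qParam]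
    rw [← Complex.exp_nat_mul, ← Complex.exp_nat_mul, ← Complex.exp_add]
    congr 1
    push_cast
    ring
  rw [SL_slash_apply, modular_T_smul, hd, one_zpow, mul_one, coe_vadd]
  simp only [Pi.smul_apply, smul_eq_mul, eta, h1, mul_pow, h2]
  ring

open ModularForm in
lemma eta_pow_four_slash_S : ∃ c : ℂ, (fun τ : ℍ ↦ eta τ ^ 4) ∣[(2 : ℤ)] ModularGroup.S =
    c • fun τ : ℍ ↦ eta τ ^ 4 := by
  have hc := eta_comp_eq_csqrt_I_inv
  set c : ℂ := (Complex.sqrt Complex.I)⁻¹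
  refine ⟨c ^ 4, ?_⟩
  ext τ
  have h := hc τ.2
  -- The fourth power removes the branch of the square root.
  have hs : Complex.sqrt τ ^ 4 = (τ : ℂ) ^ 2 := by
    rw [_root_.sqrt_eq_exp τ.ne_zero, ← Complex.exp_nat_mul]
    nth_rw 2 [← Complex.exp_log τ.ne_zero]
    rw [← Complex.exp_nat_mul]
    congr 1
    push_cast
    ring
  have hS : ((ModularGroup.S • τ : ℍ) : ℂ) = -1 / τ := by
    rw [modular_S_smul]
    simp [neg_div]
  have h' : eta ((ModularGroup.S • τ : ℍ) : ℂ) = c * (Complex.sqrt τ * eta τ) := by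
    rw [hS]
    simpa using h
  rw [SL_slash_apply, ModularGroup.denom_S]
  simp only [Pi.smul_apply, smul_eq_mul]
  have := τ.ne_zero
  rw [h', mul_pow, mul_pow, hs, zpow_neg, zpow_ofNat]
  field_simp

open ModularForm in
/-- The form `η ^ 4` has weight `2` and a character for `SL(2, ℤ)`. -/
lemma exists_character_eta_pow_four : ∃ χ : SL(2, ℤ) →* ℂˣ, ∀ (γ : SL(2, ℤ)) (τ : ℍ),
    eta (γ • τ : ℍ) ^ 4 = χ γ * denom γ τ ^ 2 * eta τ ^ 4 := by
  set e : ℍ → ℂ := fun τ ↦ eta τ ^ 4 with he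
  have hne (τ : ℍ) : e τ ≠ 0 := pow_ne_zero 4 (eta_ne_zero τ.2)
  have hex (γ : SL(2, ℤ)) : ∃ c : ℂˣ, e ∣[(2 : ℤ)] γ = (c : ℂ) • e := by
    have hunit {γ : SL(2, ℤ)} (h : ∃ c : ℂ, e ∣[(2 : ℤ)] γ = c • e) :
        ∃ c : ℂˣ, e ∣[(2 : ℤ)] γ = (c : ℂ) • e := by
      obtain ⟨c, hc⟩ := h
      refine ⟨Units.mk0 c ?_, hc⟩
      rintro rfl
      have := congrFun hc UpperHalfPlane.I
      rw [SL_slash_apply] at this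
      simp only [zero_smul, Pi.zero_apply] at this
      exact mul_ne_zero (hne _) (zpow_ne_zero _ (denom_ne_zero _ _)) this
    have hγ : γ ∈ Subgroup.closure {ModularGroup.S, ModularGroup.T} := by
      rw [SpecialLinearGroup.SL2Z_generators]
      exact Subgroup.mem_top γ
    induction hγ using Subgroup.closure_induction with
    | mem γ h =>
      rcases h with rfl | rfl
      · exact hunit eta_pow_four_slash_S
      · exact hunit ⟨_, eta_pow_four_slash_T⟩
    | one => exact ⟨1, by simp [SlashAction.slash_one]⟩
    | mul γ δ _ _ hγ hδ =>
      obtain ⟨c, hc⟩ := hγ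
      obtain ⟨d, hd⟩ := hδ
      refine ⟨c * d, ?_⟩
      rw [SlashAction.slash_mul, hc, SL_smul_slash, hd, smul_smul, Units.val_mul]
    | inv γ _ hγ =>
      obtain ⟨c, hc⟩ := hγ
      refine ⟨c⁻¹, ?_⟩
      have h1 : (e ∣[(2 : ℤ)] γ) ∣[(2 : ℤ)] γ⁻¹ = e := by
        rw [← SlashAction.slash_mul, mul_inv_cancel, SlashAction.slash_one]
      rw [hc, SL_smul_slash] at h1
      rw [← h1, smul_smul, ← Units.val_mul, inv_mul_cancel, Units.val_one, one_smul, h1]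
  choose c hc using hex
  -- The multiplier is unique because η has no zeros, hence multiplicative.
  refine ⟨MonoidHom.mk' c fun γ δ ↦ ?_, fun γ τ ↦ ?_⟩
  · have h1 : (((c (γ * δ) : ℂˣ) : ℂ) • e) = ((c γ * c δ : ℂˣ) : ℂ) • e := by
      rw [← hc, SlashAction.slash_mul, hc, SL_smul_slash, hc, smul_smul, Units.val_mul]
    have := congrFun h1 UpperHalfPlane.I
    simp only [Pi.smul_apply, smul_eq_mul] at this
    exact Units.ext (mul_right_cancel₀ (hne _) this)
  · have h1 := congrFun (hc γ) τ
    rw [SL_slash_apply, zpow_neg, ← div_eq_mul_inv,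
      div_eq_iff (zpow_ne_zero _ (denom_ne_zero _ _))] at h1
    change e (γ • τ) = _
    rw [h1]
    simp only [Pi.smul_apply, smul_eq_mul, MonoidHom.mk'_apply, zpow_ofNat, he]
    ring

end EtaCharacter

/-! ### Residues and Schwarz derivatives. -/

section Generalities

/-- A function with a primitive on a punctured neighbourhood has residue zero. -/
lemma hasResidueAt_zero_of_eventually_hasDerivAt {g h : ℂ → ℂ} {z₀ : ℂ} (hg : MeromorphicAt g z₀)
    (hh : ∀ᶠ z in 𝓝[≠] z₀, HasDerivAt h (g z) z) : HasResidueAt g z₀ 0 := by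
  refine ⟨hg, ?_⟩
  rw [eventually_nhdsWithin_iff, Metric.eventually_nhds_iff] at hh
  obtain ⟨ε, hε, hh⟩ := hh
  filter_upwards [Ioo_mem_nhdsGT hε] with r hr
  rw [circleIntegral.integral_eq_zero_of_hasDerivWithinAt hr.1.le (f := h), mul_zero]
  intro z hz
  rw [mem_sphere_iff_norm, ← dist_eq_norm] at hz
  refine (hh (hz.trans_lt hr.2) ?_).hasDerivWithinAt
  rintro rfl
  rw [dist_self] at hz
  exact hr.1.ne hz

/-- If `h' = b / y ^ 2`, where `y'' = c y`, then the Schwarz derivative of `h` is `-2 c`. -/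
lemma schwarzDeriv_eq_of_deriv_eq {y h : ℂ → ℂ} {z b c : ℂ} (hb : b ≠ 0) (hy : AnalyticAt ℂ y z)
    (hyz : y z ≠ 0) (hyc : HasDerivAt (deriv y) (c * y z) z)
    (hh : ∀ᶠ u in 𝓝 z, deriv h u = b * (y u ^ 2)⁻¹) : schwarzDeriv h z = -2 * c := by
  -- The logarithmic derivative of b y⁻² is -2y'/y; in the Schwarzian the squares (y'/y)² then
  -- cancel, leaving -2y''/y.
  have hquot : ∀ᶠ u in 𝓝 z, deriv (deriv h) u / deriv h u = -2 * (deriv y u / y u) := by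
    filter_upwards [hh.eventually_nhds, hy.eventually_analyticAt,
      hy.continuousAt.eventually_ne hyz] with u hu hya hyu
    have h1 : HasDerivAt (deriv h) _ u :=
      (((hya.differentiableAt.hasDerivAt.fun_pow 2).fun_inv (pow_ne_zero 2 hyu)).const_mul
        b).congr_of_eventuallyEq hu
    rw [h1.deriv, hu.self_of_nhds]
    field_simp
    push_cast
    ring
  have hd : deriv (fun u ↦ deriv (deriv h) u / deriv h u) z =
      -2 * ((c * y z * y z - deriv y z * deriv y z) / y z ^ 2) := by
    rw [EventuallyEq.deriv_eq hquot]
    exact ((hyc.fun_div hy.differentiableAt.hasDerivAt hyz).const_mul (-2)).deriv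
  rw [schwarzDeriv, hd, hquot.self_of_nhds]
  field_simp
  ring

end Generalities

/-! ### The form f_n in terms of Y, and the zeros of Y. -/

section Form

variable {n : ℕ} (x : Fin n → ℝ)

lemma formF_eq_eta_div_E₆ (τ : ℍ) : formF x τ = 1728 * (ModularForm.eta τ ^ 28 /
    (ModularForm.E₆ τ ^ 2 * ∏ j, (kleinJ τ - (x j : ℂ)) ^ 2)) := by
  rw [formF, kleinJ_sub_one, ModularForm.discriminant, div_mul_eq_mul_div, div_div_eq_mul_div]
  ring

/-- This holds at the poles too, where both sides take the default value 0. -/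
lemma formF_eq_nodeForm (τ : ℍ) :
    formF x τ = 1728 * (nodeForm (fun i ↦ (x i : ℂ)) τ ^ 2)⁻¹ := by
  rw [formF_eq_eta_div_E₆, nodeForm, nodePoly_eval, Finset.prod_pow, div_pow, mul_pow, inv_div,
    ← pow_mul]

lemma formF_comp_ofComplex : formF x ∘ ofComplex =
    fun z ↦ 1728 * ((nodeForm (fun i ↦ (x i : ℂ)) ∘ ofComplex) z ^ 2)⁻¹ :=
  funext fun z ↦ formF_eq_nodeForm x (ofComplex z)

lemma analyticAt_nodeForm (x : Fin n → ℂ) (τ : ℍ) : AnalyticAt ℂ (nodeForm x ∘ ofComplex) τ :=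
  DifferentiableOn.analyticAt
    (fun z hz ↦ (hasDerivAt_nodeForm x ⟨z, hz⟩).differentiableAt.differentiableWithinAt)
    (isOpen_upperHalfPlaneSet.mem_nhds τ.im_pos)

/-- The inverse of an analytic function is in normal form, even at its poles. -/
lemma meromorphicNFAt_formF (τ : ℍ) : MeromorphicNFAt (formF x ∘ ofComplex) τ := by
  have h : formF x ∘ ofComplex =
      (fun z ↦ 1728⁻¹ * (nodeForm (fun i ↦ (x i : ℂ)) ∘ ofComplex) z ^ 2)⁻¹ := by
    rw [formF_comp_ofComplex]
    ext z
    simp [mul_comm]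
  rw [h, meromorphicNFAt_inv]
  exact (analyticAt_const.mul ((analyticAt_nodeForm _ τ).fun_pow 2)).meromorphicNFAt

lemma analyticAt_formF_of_ne_zero {τ : ℍ} (h : nodeForm (fun i ↦ (x i : ℂ)) τ ≠ 0) :
    AnalyticAt ℂ (formF x ∘ ofComplex) τ := by
  rw [formF_comp_ofComplex]
  refine analyticAt_const.fun_mul (((analyticAt_nodeForm _ τ).fun_pow 2).fun_inv ?_)
  simpa using h

lemma nodeForm_eq_zero_iff {w : Fin n → ℍ} (hw : ∀ j, kleinJ (w j) = (x j : ℂ)) (τ : ℍ) :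
    nodeForm (fun i ↦ (x i : ℂ)) τ = 0 ↔ IsEquivToIOrW w τ := by
  have hη : ModularForm.eta τ ≠ 0 := ModularForm.eta_ne_zero τ.2
  rw [nodeForm, div_eq_zero_iff, or_iff_left (pow_ne_zero 14 hη), mul_eq_zero, nodePoly_eval,
    Finset.prod_eq_zero_iff, IsEquivToIOrW, mem_orbit_iff_kleinJ_eq,
    (kleinJ_eq_one_iff UpperHalfPlane.I).2 E₆_I, kleinJ_eq_one_iff]
  simp [mem_orbit_iff_kleinJ_eq, hw, sub_eq_zero]

end Form

/-! ### The Wronskian and the explicit primitive. -/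

section Wronskian

variable {n : ℕ} (x : Fin n → ℂ)

/-- Two forms of weight -1 have a Wronskian of weight 0: E₂ drops out, and E₄³ and E₆² absorb η^24,
leaving a polynomial in J. -/
lemma auxForm_nodeForm_wronskian (L : Polynomial ℂ) (τ : ℍ) :
    (-(ModularForm.E₆ τ / ModularForm.eta τ ^ 10 *
      (1 / 3 * L.eval (kleinJ τ) + kleinJ τ * L.derivative.eval (kleinJ τ))) -
        EisensteinSeries.E2 τ / 12 * auxForm L τ) * nodeForm x τ -
      auxForm L τ * (-nodeFormSerre x τ - EisensteinSeries.E2 τ / 12 * nodeForm x τ) =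
    1728 * (kleinJ τ * L.eval (kleinJ τ) * (nodeCompanion x).eval (kleinJ τ) -
      (kleinJ τ - 1) * (nodePoly x).eval (kleinJ τ) *
        (1 / 3 * L.eval (kleinJ τ) + kleinJ τ * L.derivative.eval (kleinJ τ))) := by
  have hη : ModularForm.eta τ ≠ 0 := ModularForm.eta_ne_zero τ.2
  have h4 := kleinJ_mul_eta τ
  have h6 := kleinJ_sub_one_mul_eta τ
  rw [nodeForm, nodeFormSerre, auxForm]
  field_simp
  linear_combination -36 * L.eval (kleinJ τ) * (nodeCompanion x).eval (kleinJ τ) * h4 +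
    12 * (nodePoly x).eval (kleinJ τ) *
      (L.eval (kleinJ τ) + 3 * kleinJ τ * L.derivative.eval (kleinJ τ)) * h6

/-- `L` and `v` make the Wronskian of `auxForm L` and `nodeForm x` equal to
`1728 (1 + (J - 1) p(J) ^ 2 v(J))`, up to the factor `2πi`. -/
def IsBezoutPair (L v : Polynomial ℂ) : Prop :=
  Polynomial.X * L * nodeCompanion x - (Polynomial.X - 1) * nodePoly x *
    (Polynomial.C (1 / 3) * L + Polynomial.X * Polynomial.derivative L) =
      1 + (Polynomial.X - 1) * nodePoly x ^ 2 * v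

variable {x}

lemma auxForm_nodeForm_wronskian_eq {L v : Polynomial ℂ} (hL : IsBezoutPair x L v) (τ : ℍ) :
    (-(ModularForm.E₆ τ / ModularForm.eta τ ^ 10 *
      (1 / 3 * L.eval (kleinJ τ) + kleinJ τ * L.derivative.eval (kleinJ τ))) -
        EisensteinSeries.E2 τ / 12 * auxForm L τ) * nodeForm x τ -
      auxForm L τ * (-nodeFormSerre x τ - EisensteinSeries.E2 τ / 12 * nodeForm x τ) =
    1728 + nodeForm x τ ^ 2 * (v.eval (kleinJ τ) * ModularForm.eta τ ^ 4) := by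
  have hη : ModularForm.eta τ ≠ 0 := ModularForm.eta_ne_zero τ.2
  have h6 := kleinJ_sub_one_mul_eta τ
  have h := congrArg (Polynomial.eval (kleinJ τ)) hL
  simp only [Polynomial.eval_add, Polynomial.eval_sub, Polynomial.eval_mul, Polynomial.eval_X,
    Polynomial.eval_C, Polynomial.eval_one, Polynomial.eval_pow] at h
  have hY : nodeForm x τ ^ 2 * ModularForm.eta τ ^ 4 =
      1728 * ((kleinJ τ - 1) * (nodePoly x).eval (kleinJ τ) ^ 2) := by
    rw [nodeForm]
    field_simp
    linear_combination -(nodePoly x).eval (kleinJ τ) ^ 2 * h6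
  rw [auxForm_nodeForm_wronskian, h]
  linear_combination -v.eval (kleinJ τ) * hY

/-- At a zero of Y the Wronskian identity reads Z · `nodeFormSerre` = 1728. -/
lemma nodeFormSerre_ne_zero {L v : Polynomial ℂ} (hL : IsBezoutPair x L v) {τ : ℍ} (hτ : nodeForm x τ = 0) :
    nodeFormSerre x τ ≠ 0 := by
  intro h
  have := auxForm_nodeForm_wronskian_eq hL τ
  rw [hτ, h] at this
  norm_num at this

lemma deriv_nodeForm_ne_zero {L v : Polynomial ℂ} (hL : IsBezoutPair x L v) {τ : ℍ} (hτ : nodeForm x τ = 0) :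
    deriv (nodeForm x ∘ ofComplex) τ ≠ 0 := by
  rw [(hasDerivAt_nodeForm x τ).deriv, hτ, mul_zero, sub_zero]
  exact mul_ne_zero Complex.two_pi_I_ne_zero (neg_ne_zero.2 (nodeFormSerre_ne_zero hL hτ))

lemma eventually_nodeForm_ne_zero {L v : Polynomial ℂ} (hL : IsBezoutPair x L v) {τ : ℍ} (hτ : nodeForm x τ = 0) :
    ∀ᶠ z in 𝓝[≠] (τ : ℂ), (nodeForm x ∘ ofComplex) z ≠ 0 :=
  (hasDerivAt_nodeForm x τ).differentiableAt.hasDerivAt.eventually_ne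
    (deriv_nodeForm_ne_zero hL hτ)

/-- The form `1728 / nodeForm ^ 2` has a primitive, holomorphic off the zeros of `nodeForm`. -/
lemma exists_primitive_inv_nodeForm_sq {L v : Polynomial ℂ} (hL : IsBezoutPair x L v) :
    ∃ h : ℂ → ℂ, (∀ τ : ℍ, MeromorphicAt h τ) ∧
      ∀ τ : ℍ, nodeForm x τ ≠ 0 → HasDerivAt h (1728 * (nodeForm x τ ^ 2)⁻¹) τ := by
  -- H absorbs the holomorphic error term v(J) η⁴ in (Z/Y)' = 2πi (1728/Y² + v(J) η⁴).
  obtain ⟨H, hH⟩ := exists_primitive_upperHalfPlane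
    (g := fun z ↦ v.eval (kleinJ (ofComplex z)) * ModularForm.eta (ofComplex z) ^ 4)
    fun z hz ↦ ((hasDerivAt_eval_kleinJ v ⟨z, hz⟩).fun_mul ((hasDerivAt_eta_comp_ofComplex
      ⟨z, hz⟩).fun_pow 4)).differentiableAt.differentiableWithinAt
  refine ⟨fun z ↦ (2 * Real.pi * Complex.I)⁻¹ *
    ((auxForm L ∘ ofComplex) z / (nodeForm x ∘ ofComplex) z) - H z, fun τ ↦ ?_, fun τ hτ ↦ ?_⟩
  · have hA : AnalyticAt ℂ (auxForm L ∘ ofComplex) τ := DifferentiableOn.analyticAt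
      (fun z hz ↦ (hasDerivAt_auxForm L ⟨z, hz⟩).differentiableAt.differentiableWithinAt)
      (isOpen_upperHalfPlaneSet.mem_nhds τ.im_pos)
    have hHa : AnalyticAt ℂ H τ := DifferentiableOn.analyticAt
      (fun z hz ↦ (hH z hz).differentiableAt.differentiableWithinAt)
      (isOpen_upperHalfPlaneSet.mem_nhds τ.im_pos)
    exact ((MeromorphicAt.const _ _).fun_mul (hA.meromorphicAt.fun_div
      (analyticAt_nodeForm x τ).meromorphicAt)).fun_sub hHa.meromorphicAt
  · have hτ' : (nodeForm x ∘ ofComplex) τ ≠ 0 := by simpa using hτ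
    have h := (((hasDerivAt_auxForm L τ).fun_div (hasDerivAt_nodeForm x τ) hτ').const_mul
      (2 * Real.pi * Complex.I : ℂ)⁻¹).fun_sub (hH τ τ.im_pos)
    refine h.congr_deriv ?_
    have hW := auxForm_nodeForm_wronskian_eq hL τ
    have hκ := Complex.two_pi_I_ne_zero
    simp only [Function.comp_apply, ofComplex_apply] at *
    set κ : ℂ := 2 * Real.pi * Complex.I
    generalize nodeForm x τ = Y at *
    field_simp at hW ⊢
    linear_combination hW

end Wronskian

/-! ### Poles, residues and meromorphic primitives of f_n. -/

section Poles

variable {n : ℕ} {x : Fin n → ℝ} {L v : Polynomial ℂ}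

lemma meromorphicOrderAt_formF (hL : IsBezoutPair (fun i ↦ (x i : ℂ)) L v)
    {τ : ℍ} (hτ : nodeForm (fun i ↦ (x i : ℂ)) τ = 0) :
    meromorphicOrderAt (formF x ∘ ofComplex) τ = ((-2 : ℤ) : WithTop ℤ) := by
  have ha := analyticAt_nodeForm (fun i ↦ (x i : ℂ)) τ
  have h1 : meromorphicOrderAt (nodeForm (fun i ↦ (x i : ℂ)) ∘ ofComplex) τ = 1 := by
    rw [ha.meromorphicOrderAt_eq, ha.analyticOrderAt_eq_one_of_zero_deriv_ne_zero
      (by simpa using hτ) (deriv_nodeForm_ne_zero hL hτ)]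
    rfl
  have h2 : formF x ∘ ofComplex =
      (fun _ ↦ 1728) * ((nodeForm (fun i ↦ (x i : ℂ)) ∘ ofComplex) ^ 2)⁻¹ :=
    formF_comp_ofComplex x
  rw [h2, meromorphicOrderAt_mul (MeromorphicAt.const _ _) (ha.meromorphicAt.pow 2).inv,
    meromorphicOrderAt_inv, meromorphicOrderAt_pow ha.meromorphicAt, h1,
    meromorphicOrderAt_const, if_neg (by norm_num)]
  rfl

lemma nodeForm_ne_zero_of_analyticAt_formF (hL : IsBezoutPair (fun i ↦ (x i : ℂ)) L v)
    {τ : ℍ} (h : AnalyticAt ℂ (formF x ∘ ofComplex) τ) :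
    nodeForm (fun i ↦ (x i : ℂ)) τ ≠ 0 := by
  intro hτ
  have := h.meromorphicOrderAt_nonneg
  rw [meromorphicOrderAt_formF hL hτ] at this
  exact absurd this (by decide)

lemma hasResidueAt_formF (hL : IsBezoutPair (fun i ↦ (x i : ℂ)) L v)
    {τ : ℍ} (hτ : nodeForm (fun i ↦ (x i : ℂ)) τ = 0) :
    HasResidueAt (formF x ∘ ofComplex) τ 0 := by
  obtain ⟨h, -, hh⟩ := exists_primitive_inv_nodeForm_sq hL
  refine hasResidueAt_zero_of_eventually_hasDerivAt (h := h)
    (meromorphicNFAt_formF x τ).meromorphicAt ?_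
  filter_upwards [eventually_nodeForm_ne_zero hL hτ, eventually_nhdsWithin_of_eventually_nhds
    (isOpen_upperHalfPlaneSet.mem_nhds τ.im_pos)] with z hz hz'
  simp only [Function.comp_apply, formF_eq_nodeForm, ofComplex_apply_of_im_pos hz'] at hz ⊢
  exact hh ⟨z, hz'⟩ hz

lemma exists_isMeromorphicPrimitive_formF (hL : IsBezoutPair (fun i ↦ (x i : ℂ)) L v) :
    ∃ h : ℍ → ℂ, IsMeromorphicPrimitive (formF x) h := by
  obtain ⟨h, hm, hh⟩ := exists_primitive_inv_nodeForm_sq hL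
  have hE (τ : ℍ) : (fun τ : ℍ ↦ h τ) ∘ ofComplex =ᶠ[𝓝 (τ : ℂ)] h := by
    filter_upwards [isOpen_upperHalfPlaneSet.mem_nhds τ.im_pos] with z hz
    simp [ofComplex_apply_of_im_pos hz]
  refine ⟨fun τ ↦ h τ, fun z hz ↦ ?_, fun τ hτ ↦ ?_⟩
  · exact (hm ⟨z, hz⟩).congr ((hE ⟨z, hz⟩).symm.filter_mono nhdsWithin_le_nhds)
  · rw [formF_eq_nodeForm]
    exact (hh τ (nodeForm_ne_zero_of_analyticAt_formF hL hτ)).congr_of_eventuallyEq (hE τ)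

end Poles

/-! ### Behaviour at the cusp. -/

section Cusp

lemma kleinJ_eq_cuspFunction (τ : ℍ) : kleinJ τ =
    cuspFunction 1 ModularForm.E₄ (Function.Periodic.qParam 1 τ) ^ 3 /
      (1728 * cuspFunction 1 CuspForm.discriminant (Function.Periodic.qParam 1 τ)) := by
  rw [SlashInvariantFormClass.eq_cuspFunction ModularForm.E₄ τ one_mem_strictPeriods_SL one_ne_zero,
    SlashInvariantFormClass.eq_cuspFunction CuspForm.discriminant τ one_mem_strictPeriods_SL
      one_ne_zero]
  rfl

lemma qParam_six_pow_six (z : ℂ) :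
    Function.Periodic.qParam 6 z ^ 6 = Function.Periodic.qParam 1 z := by
  simp only [Function.Periodic.qParam, ← Complex.exp_nat_mul]
  congr 1
  push_cast
  ring

lemma eta_pow_four_eq_qParam_six (z : ℂ) : ModularForm.eta z ^ 4 =
    Function.Periodic.qParam 6 z * (∏' n : ℕ, (1 - Function.Periodic.qParam 1 z ^ (n + 1))) ^ 4 := by
  rw [ModularForm.eta, mul_pow]
  congr 1
  simp only [Function.Periodic.qParam, ← Complex.exp_nat_mul]
  congr 1
  push_cast
  ring

/-- In the variable q^{1/6}, η⁴ is that variable times the fourth power of an analytic product in q,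
and J is meromorphic in q. Only η⁴ needs the sixth root. -/
lemma formF_meromorphic_at_cusp {n : ℕ} (x : Fin n → ℝ) : ∃ F : ℂ → ℂ, MeromorphicAt F 0 ∧
    ∀ τ : ℍ, formF x τ = F (Function.Periodic.qParam 6 τ) := by
  let K : ℂ → ℂ := fun q ↦ cuspFunction 1 ModularForm.E₄ q ^ 3 /
    (1728 * cuspFunction 1 CuspForm.discriminant q)
  have hK : MeromorphicAt K 0 :=
    ((ModularFormClass.analyticAt_cuspFunction_zero ModularForm.E₄ one_pos
      one_mem_strictPeriods_SL).meromorphicAt.fun_pow 3).fun_div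
      ((MeromorphicAt.const _ _).fun_mul (ModularFormClass.analyticAt_cuspFunction_zero
        CuspForm.discriminant one_pos one_mem_strictPeriods_SL).meromorphicAt)
  let P : ℂ → ℂ := fun q ↦ ∏' n : ℕ, (1 - q ^ (n + 1))
  have hP : AnalyticAt ℂ P 0 :=
    ModularForm.differentiableOn_tprod_one_sub_pow.analyticAt (Metric.ball_mem_nhds 0 one_pos)
  have hpow : AnalyticAt ℂ (fun q : ℂ ↦ q ^ 6) 0 := by fun_prop
  have hK6 : MeromorphicAt (fun q ↦ K (q ^ 6)) 0 :=
    MeromorphicAt.comp_analyticAt (f := K) (by simpa using hK) hpow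
  have hP6 : MeromorphicAt (fun q ↦ P (q ^ 6)) 0 :=
    MeromorphicAt.comp_analyticAt (f := P) (by simpa using hP.meromorphicAt) hpow
  refine ⟨fun q ↦ q * P (q ^ 6) ^ 4 /
    ((K (q ^ 6) - 1) * ∏ i, (K (q ^ 6) - (x i : ℂ)) ^ 2), ?_, fun τ ↦ ?_⟩
  · exact ((MeromorphicAt.id 0).fun_mul (hP6.fun_pow 4)).fun_div
      ((hK6.fun_sub (MeromorphicAt.const _ _)).fun_mul (MeromorphicAt.fun_prod fun i _ ↦
        (hK6.fun_sub (MeromorphicAt.const _ _)).fun_pow 2))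
  · simp only [qParam_six_pow_six, K, P, formF, ← kleinJ_eq_cuspFunction,
      eta_pow_four_eq_qParam_six]

end Cusp

/-! ### Modularity with character, and the theorem. -/

lemma exists_character_formF {n : ℕ} (x : Fin n → ℝ) :
    ∃ χ : SL(2, ℤ) →* ℂˣ, IsMeromorphicModularFormWtTwo χ (formF x) := by
  obtain ⟨χ, hχ⟩ := exists_character_eta_pow_four
  obtain ⟨F, hF, hFx⟩ := formF_meromorphic_at_cusp x
  refine ⟨χ, fun z hz ↦ meromorphicNFAt_formF x ⟨z, hz⟩, fun γ ↦ ?_,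
    F, hF, Eventually.of_forall hFx⟩
  ext τ
  rw [ModularForm.SL_slash_apply, formF, formF, kleinJ_smul, hχ, zpow_neg, zpow_ofNat]
  have := denom_ne_zero γ τ
  field_simp

theorem theorem3p1 (n : ℕ) (x : Fin n → ℝ) (hx01 : ∀ j, x j ∈ Set.Ioo (0 : ℝ) 1)
    (hx : SolvesSystem 4 9 12 x) (w : Fin n → ℍ) (hw : ∀ j, kleinJ (w j) = (x j : ℂ)) :
    -- the two expressions for the form
    (∀ τ : ℍ, formF x τ = 1728 * (ModularForm.eta τ ^ 28 /
        (ModularForm.E₆ τ ^ 2 * ∏ j, (kleinJ τ - (x j : ℂ)) ^ 2))) ∧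
    -- it is a meromorphic modular form of weight 2 with a character
    (∃ χ : SL(2, ℤ) →* ℂˣ, IsMeromorphicModularFormWtTwo χ (formF x)) ∧
    -- double poles with zero residue at `i`, at each `w j`, and at their translates
    (∀ τ : ℍ, IsEquivToIOrW w τ →
      meromorphicOrderAt (formF x ∘ ofComplex) τ = ((-2 : ℤ) : WithTop ℤ) ∧
        HasResidueAt (formF x ∘ ofComplex) τ 0) ∧
    -- holomorphic and nonvanishing elsewhere
    (∀ τ : ℍ, ¬ IsEquivToIOrW w τ →
      AnalyticAt ℂ (formF x ∘ ofComplex) τ ∧ formF x τ ≠ 0) ∧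
    -- the integral exists as a meromorphic function on the upper half-plane
    (∃ h : ℍ → ℂ, IsMeromorphicPrimitive (formF x) h) ∧
    -- its Schwarz derivative, whatever the constant of integration
    (∀ h : ℍ → ℂ, IsMeromorphicPrimitive (formF x) h → ∀ τ : ℍ, ¬ IsEquivToIOrW w τ →
      schwarzDeriv (h ∘ ofComplex) τ =
        2 * (Real.pi : ℂ) ^ 2 * ((12 * (n : ℂ) + 7) / 6) ^ 2 * ModularForm.E₄ τ) := by
  obtain ⟨hinj, hne, hsys⟩ := hx
  have hinj' : Function.Injective (fun i ↦ (x i : ℂ)) := Complex.ofReal_injective.comp hinj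
  have hne' (j : Fin n) : (x j : ℂ) ≠ 0 ∧ (x j : ℂ) ≠ 1 := by exact_mod_cast hne j
  have hsys' (j : Fin n) : 4 / (x j : ℂ) + 9 / ((x j : ℂ) - 1) +
      ∑ i ∈ Finset.univ.erase j, 12 / ((x j : ℂ) - (x i : ℂ)) = 0 := by
    exact_mod_cast congrArg Complex.ofReal (hsys j)
  obtain ⟨L, v, hL : IsBezoutPair _ L v⟩ := exists_interpolating_poly hinj' hne' hsys'
  refine ⟨formF_eq_eta_div_E₆ x, exists_character_formF x, fun τ hτ ↦ ?_, fun τ hτ ↦ ?_,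
    exists_isMeromorphicPrimitive_formF hL, fun h hh τ hτ ↦ ?_⟩
  · rw [← nodeForm_eq_zero_iff x hw] at hτ
    exact ⟨meromorphicOrderAt_formF hL hτ, hasResidueAt_formF hL hτ⟩
  · rw [← nodeForm_eq_zero_iff x hw] at hτ
    refine ⟨analyticAt_formF_of_ne_zero x hτ, ?_⟩
    rw [formF_eq_nodeForm]
    exact mul_ne_zero (by norm_num) (inv_ne_zero (pow_ne_zero 2 hτ))
  · rw [← nodeForm_eq_zero_iff x hw] at hτ
    have ha := analyticAt_nodeForm (fun i ↦ (x i : ℂ)) τ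
    have hτ' : (nodeForm (fun i ↦ (x i : ℂ)) ∘ ofComplex) τ ≠ 0 := by simpa using hτ
    have hS := schwarzDeriv_eq_of_deriv_eq (h := h ∘ ofComplex) (b := 1728)
      (c := -(Real.pi : ℂ) ^ 2 * ((12 * n + 7) / 6) ^ 2 * ModularForm.E₄ τ) (by norm_num) ha hτ'
      (by simpa using hasDerivAt_deriv_nodeForm hinj' hne' hsys' τ) ?_
    · rw [hS]
      ring
    · filter_upwards [ha.continuousAt.eventually_ne hτ',
        isOpen_upperHalfPlaneSet.mem_nhds τ.im_pos] with z hz hz'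
      simp only [Function.comp_apply, ofComplex_apply_of_im_pos hz'] at hz ⊢
      rw [← formF_eq_nodeForm]
      exact (hh.2 ⟨z, hz'⟩ (analyticAt_formF_of_ne_zero x hz)).deriv
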